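/- Let $(M,g)$ be a smooth four-dimensional manifold with a smooth Lorentzian metric of signature $(+,-,-,-)$ and Levi-Civita connection $\nabla$. **Definitions.** A *null frame* on an open set $U\subseteq M$ is a quadruple $(\ell,n,m,\bar m)$ of smooth vector fields on $U$, with $\ell,n$ real and $m$ complex, whose only non-vanishing scalar products are $g(\ell,n)=1$ and $g(m,\bar m)=-1$. Its spin coefficients $\kappa,\rho,\sigma,\epsilon$ are $$\kappa=m^a\ell^b\nabla_b\ell_a,\quad \rho=m^a\bar m^b\nabla_b\ell_a,\quad \sigma=m^am^b\nabla_b\ell_a,\quad \epsilon=\tfrac12\left(n^a\ell^b\nabla_b\ell_a-\bar m^a\ell^b\nabla_b m_a\right).$$ A *null rotation about $\ell$* is a transformation $$\ell\mapsto\ell,\qquad m\mapsto m+z\ell,\qquad n\mapsto n+\bar z m+z\bar m+z\bar z\,\ell,$$ with $z$ a smooth complex function. A *spin-boost* is a transformation $$\ell\mapsto A\ell,\qquad n\mapsto A^{-1}n,\qquad m\mapsto w\,m,$$ with smooth functions $A>0$ and $w\in\mathbb C$, $|w|=1$. The space $(M,g)$ *defines a Kundt geometry near $p\in M$* if on some open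 neighbourhood $U$ of $p$ there is a null congruence (a smooth nowhere vanishing real null vector field $\ell$, tangent to the congruence) that is - hypersurface orthogonal (normal, non-twisting), i.e. the one-form $\omega=g(\ell,\cdot)$ satisfies $\omega\wedge d\omega=0$; - non-diverging, i.e. $B(x,x)+B(y,y)=0$, where $B(x,y)=g(\nabla_x\ell,y)$; - non-shearing, i.e. $B(x,x)=B(y,y)$ and $B(x,y)+B(y,x)=0$; the last two for every $q\in U$ and all $x,y\in T_qM$ orthogonal to $\ell$ with $g(x,x)=g(y,y)=-1$ and $g(x,y)=0$. **Lemma.** 1. For every $p\in M$, $(M,g)$ defines a Kundt geometry near $p$ if and only if on some open neighbourhood of $p$ there exists a (nonempty) family of null frames, defined up to null rotations about $\ell$ and spin-boosts (that is, the family consists of all null frames obtained from any one of its members by compositions of such transformations and their inverses), all of whose members satisfy $$\kappa=\rho=\sigma=0 .$$ 2. Let $(\ell,n,m,\bar m)$ be a null frame on an open set $U$ with $\kappa=\rho=\sigma=0$. Every spin-boost of this frame on $U$ again satisfies $\kappa=\rho=\sigma=0$. Moreover every $p\in U$ has an open neighbourhood $V\subseteq U$ on which some spin-boost of the frame satisfies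 $\kappa=\rho=\sigma=\epsilon=0$, and an open neighbourhood $V'\subseteq U$ on which some spin-boost of the frame satisfies $\kappa=\rho=\sigma=0$ and $\epsilon\neq0$ at every point. -/

import Mathlib

open Set Topology
open scoped Manifold ContDiff Bundle

namespace Kundt

/-- A vector field (not necessarily continuous) on a four-dimensional manifold. -/
abbrev VField (M : Type*) [TopologicalSpace M] [ChartedSpace (EuclideanSpace ℝ (Fin 4)) M] :=
  Π p : M, TangentSpace (𝓡 4) p

/-- A smooth metric of signature `(+,-,-,-)` on a four-dimensional manifold. -/
structure LorentzMetric (M : Type*) [TopologicalSpace M]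
    [ChartedSpace (EuclideanSpace ℝ (Fin 4)) M] [IsManifold (𝓡 4) ∞ M] where
  /-- The scalar product on each tangent space. -/
  inner (p : M) : TangentSpace (𝓡 4) p →L[ℝ] TangentSpace (𝓡 4) p →L[ℝ] ℝ
  symm (p : M) (v w : TangentSpace (𝓡 4) p) : inner p v w = inner p w v
  signature (p : M) : ∃ e : Fin 4 → TangentSpace (𝓡 4) p, ∀ i j,
    inner p (e i) (e j) = Matrix.diagonal ![(1 : ℝ), -1, -1, -1] i j
  contMDiff : ContMDiff (𝓡 4)
    ((𝓡 4).prod 𝓘(ℝ, EuclideanSpace ℝ (Fin 4) →L[ℝ] EuclideanSpace ℝ (Fin 4) →L[ℝ] ℝ)) ∞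
    (fun p ↦ Bundle.TotalSpace.mk'
      (EuclideanSpace ℝ (Fin 4) →L[ℝ] EuclideanSpace ℝ (Fin 4) →L[ℝ] ℝ) p (inner p))

section Fields

variable {M : Type*} [TopologicalSpace M] [ChartedSpace (EuclideanSpace ℝ (Fin 4)) M]

/-- The vector field `X` is smooth at the point `p` (hence is defined by a germ there). -/
def SmoothFieldAt [IsManifold (𝓡 4) ∞ M] (X : VField M) (p : M) : Prop :=
  ContMDiffAt (𝓡 4) (𝓡 4).tangent ∞
    (fun q ↦ (⟨q, X q⟩ : TangentBundle (𝓡 4) M)) p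

/-- The vector field `X` is smooth on the set `U`. -/
def SmoothFieldOn [IsManifold (𝓡 4) ∞ M] (X : VField M) (U : Set M) : Prop :=
  ContMDiffOn (𝓡 4) (𝓡 4).tangent ∞
    (fun q ↦ (⟨q, X q⟩ : TangentBundle (𝓡 4) M)) U

/-- The directional derivative `X(f)` of a real function. -/
noncomputable def dir (X : VField M) (f : M → ℝ) (p : M) : ℝ :=
  mvfderiv (𝓡 4) f p (X p)

/-- The Lie bracket `[X, Y]`. -/
noncomputable def bracket (X Y : VField M) : VField M :=
  VectorField.mlieBracket (𝓡 4) X Y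

/-- A complex vector field `re + i im`, that is, a section of the complexified tangent bundle. -/
structure CField (M : Type*) [TopologicalSpace M]
    [ChartedSpace (EuclideanSpace ℝ (Fin 4)) M] where
  re : VField M
  im : VField M

/-- A real vector field, regarded as a complex one. -/
noncomputable def CField.ofReal (X : VField M) : CField M := ⟨X, fun _ ↦ 0⟩

/-- Complex conjugation of vector fields. -/
noncomputable def CField.conj (Z : CField M) : CField M := ⟨Z.re, fun q ↦ - Z.im q⟩

/-- Two real vector fields `ℓ, n` and a complex one `m`; together with the conjugate of `m`
they form the tetrad `(ℓ, n, m, m̄)`. -/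
structure Tetrad (M : Type*) [TopologicalSpace M]
    [ChartedSpace (EuclideanSpace ℝ (Fin 4)) M] where
  l : VField M
  n : VField M
  m : CField M

end Fields

section Metric

variable {M : Type*} [TopologicalSpace M] [ChartedSpace (EuclideanSpace ℝ (Fin 4)) M]
  [IsManifold (𝓡 4) ∞ M]

/-- The function `g(X, Y)`. -/
noncomputable def LorentzMetric.pair (g : LorentzMetric M) (X Y : VField M) (p : M) : ℝ :=
  g.inner p (X p) (Y p)

/-- `g(∇_X Y, Z)` for the Levi-Civita connection `∇` of `g`, given by the Koszul formula. -/
noncomputable def LorentzMetric.nabla (g : LorentzMetric M) (X Y Z : VField M) (p : M) : ℝ :=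
  (dir X (g.pair Y Z) p + dir Y (g.pair X Z) p - dir Z (g.pair X Y) p
    + g.pair (bracket X Y) Z p - g.pair (bracket X Z) Y p - g.pair (bracket Y Z) X p) / 2

/-- `dω(X, Y)` for the one-form `ω = g(L, ·)` metrically dual to the vector field `L`. -/
noncomputable def LorentzMetric.dFlat (g : LorentzMetric M) (L X Y : VField M) (p : M) : ℝ :=
  dir X (g.pair L Y) p - dir Y (g.pair L X) p - g.pair L (bracket X Y) p

/-- The complex bilinear extension of `g`. -/
noncomputable def LorentzMetric.cpair (g : LorentzMetric M) (X Y : CField M) (p : M) : ℂ :=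
  ⟨g.pair X.re Y.re p - g.pair X.im Y.im p, g.pair X.re Y.im p + g.pair X.im Y.re p⟩

/-- The complex trilinear extension of `g(∇_X Y, Z)`. -/
noncomputable def LorentzMetric.cnabla (g : LorentzMetric M) (X Y Z : CField M) (p : M) : ℂ :=
  ⟨g.nabla X.re Y.re Z.re p - g.nabla X.re Y.im Z.im p
      - g.nabla X.im Y.re Z.im p - g.nabla X.im Y.im Z.re p,
    g.nabla X.im Y.re Z.re p + g.nabla X.re Y.im Z.re p
      + g.nabla X.re Y.re Z.im p - g.nabla X.im Y.im Z.im p⟩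

/-! ### Null congruences -/

/-- `L` is a smooth, nowhere vanishing null vector field on `U`, i.e. it is tangent to a
congruence of null curves filling `U`. -/
def IsNullFieldOn (g : LorentzMetric M) (U : Set M) (L : VField M) : Prop :=
  SmoothFieldOn L U ∧ ∀ q ∈ U, L q ≠ 0 ∧ g.pair L L q = 0

/-- `L` is hypersurface orthogonal (normal, non-twisting) on `U`: the dual one-form `ω` satisfies
`ω ∧ dω = 0`. -/
def IsHypersurfaceOrthogonalOn (g : LorentzMetric M) (U : Set M) (L : VField M) : Prop :=
  ∀ q ∈ U, ∀ X Y Z : VField M, SmoothFieldAt X q → SmoothFieldAt Y q → SmoothFieldAt Z q →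
    g.pair L X q * g.dFlat L Y Z q + g.pair L Y q * g.dFlat L Z X q
      + g.pair L Z q * g.dFlat L X Y q = 0

/-- The values at `q` of `X, Y` form an orthonormal pair of (spacelike) vectors orthogonal to `L`,
i.e. an orthonormal basis of a screen space: a complement of `L` in its orthogonal space. -/
def IsScreenPairAt (g : LorentzMetric M) (L X Y : VField M) (q : M) : Prop :=
  SmoothFieldAt X q ∧ SmoothFieldAt Y q ∧ g.pair L X q = 0 ∧ g.pair L Y q = 0 ∧
    g.pair X X q = -1 ∧ g.pair Y Y q = -1 ∧ g.pair X Y q = 0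

/-- The expansion of `L`, the trace of `B(X, Y) = g(∇_X L, Y)` on screen spaces, vanishes. -/
def IsNonDivergingOn (g : LorentzMetric M) (U : Set M) (L : VField M) : Prop :=
  ∀ q ∈ U, ∀ X Y : VField M, IsScreenPairAt g L X Y q →
    g.nabla X L X q + g.nabla Y L Y q = 0

/-- The shear of `L`, the trace-free symmetric part of `B(X, Y) = g(∇_X L, Y)` on screen spaces,
vanishes. -/
def IsNonShearingOn (g : LorentzMetric M) (U : Set M) (L : VField M) : Prop :=
  ∀ q ∈ U, ∀ X Y : VField M, IsScreenPairAt g L X Y q →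
    g.nabla X L X q = g.nabla Y L Y q ∧ g.nabla X L Y q + g.nabla Y L X q = 0

/-- `(M, g)` defines a Kundt geometry near `p`: on a neighbourhood of `p` there is a null
congruence whose tangent vector field is hypersurface orthogonal, non-diverging and
non-shearing. (That it is geodesic is a consequence.) -/
def IsKundtNear (g : LorentzMetric M) (p : M) : Prop :=
  ∃ U : Set M, IsOpen U ∧ p ∈ U ∧ ∃ L : VField M, IsNullFieldOn g U L ∧
    IsHypersurfaceOrthogonalOn g U L ∧ IsNonDivergingOn g U L ∧ IsNonShearingOn g U L

/-! ### Null frames and spin coefficients -/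

/-- A smooth null frame `(ℓ, n, m, m̄)` on `U`: the only nonzero products are `g(ℓ, n) = 1` and
`g(m, m̄) = -1`. The values of the fields off `U` are irrelevant. -/
structure NullFrame (g : LorentzMetric M) (U : Set M) extends Tetrad M where
  smooth_l : SmoothFieldOn l U
  smooth_n : SmoothFieldOn n U
  smooth_re : SmoothFieldOn m.re U
  smooth_im : SmoothFieldOn m.im U
  l_l : ∀ q ∈ U, g.pair l l q = 0
  n_n : ∀ q ∈ U, g.pair n n q = 0
  l_n : ∀ q ∈ U, g.pair l n q = 1
  l_m : ∀ q ∈ U, g.cpair (.ofReal l) m q = 0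
  n_m : ∀ q ∈ U, g.cpair (.ofReal n) m q = 0
  m_m : ∀ q ∈ U, g.cpair m m q = 0
  m_conj : ∀ q ∈ U, g.cpair m m.conj q = -1

/-- `κ = m^a ℓ^b ∇_b ℓ_a`. -/
noncomputable def kappa (g : LorentzMetric M) (e : Tetrad M) (q : M) : ℂ :=
  g.cnabla (.ofReal e.l) (.ofReal e.l) e.m q

/-- `ρ = m^a m̄^b ∇_b ℓ_a`. -/
noncomputable def rho (g : LorentzMetric M) (e : Tetrad M) (q : M) : ℂ :=
  g.cnabla e.m.conj (.ofReal e.l) e.m q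

/-- `σ = m^a m^b ∇_b ℓ_a`. -/
noncomputable def sigma (g : LorentzMetric M) (e : Tetrad M) (q : M) : ℂ :=
  g.cnabla e.m (.ofReal e.l) e.m q

/-- `ε = (n^a ℓ^b ∇_b ℓ_a - m̄^a ℓ^b ∇_b m_a) / 2`. -/
noncomputable def epsilon (g : LorentzMetric M) (e : Tetrad M) (q : M) : ℂ :=
  (g.cnabla (.ofReal e.l) (.ofReal e.l) (.ofReal e.n) q
    - g.cnabla (.ofReal e.l) e.m e.m.conj q) / 2

/-- `κ = ρ = σ = 0` on `U`. -/
def KundtConditionsOn (g : LorentzMetric M) (U : Set M) (e : Tetrad M) : Prop :=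
  ∀ q ∈ U, kappa g e q = 0 ∧ rho g e q = 0 ∧ sigma g e q = 0

/-- On `U`, `e'` arises from `e` by a null rotation about `ℓ` with a smooth complex parameter `z`:
`ℓ' = ℓ`, `m' = m + z ℓ`, `n' = n + z̄ m + z m̄ + z z̄ ℓ`. -/
def IsNullRotationOn (U : Set M) (e e' : Tetrad M) : Prop :=
  ∃ z : M → ℂ, ContMDiffOn (𝓡 4) 𝓘(ℝ, ℂ) ∞ z U ∧ ∀ q ∈ U,
    e'.l q = e.l q ∧
    e'.m.re q = e.m.re q + (z q).re • e.l q ∧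
    e'.m.im q = e.m.im q + (z q).im • e.l q ∧
    e'.n q = e.n q + (2 : ℝ) • ((z q).re • e.m.re q + (z q).im • e.m.im q)
      + Complex.normSq (z q) • e.l q

/-- On `U`, `e'` arises from `e` by a spin-boost with a smooth boost parameter `A > 0` and a
smooth phase `w`, `|w| = 1`: `ℓ' = A ℓ`, `n' = A⁻¹ n`, `m' = w m`. -/
def IsSpinBoostOn (U : Set M) (e e' : Tetrad M) : Prop :=
  ∃ (A : M → ℝ) (w : M → ℂ), ContMDiffOn (𝓡 4) 𝓘(ℝ, ℝ) ∞ A U ∧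
    ContMDiffOn (𝓡 4) 𝓘(ℝ, ℂ) ∞ w U ∧ ∀ q ∈ U, 0 < A q ∧ ‖w q‖ = 1 ∧
      e'.l q = A q • e.l q ∧
      e'.n q = (A q)⁻¹ • e.n q ∧
      e'.m.re q = (w q).re • e.m.re q - (w q).im • e.m.im q ∧
      e'.m.im q = (w q).re • e.m.im q + (w q).im • e.m.re q

/-- Two null frames on `U` are related by null rotations about `ℓ` and spin-boosts. -/
def SameFamily {g : LorentzMetric M} {U : Set M} (e e' : NullFrame g U) : Prop :=
  Relation.EqvGen (fun a b : NullFrame g U ↦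
    IsNullRotationOn U a.toTetrad b.toTetrad ∨ IsSpinBoostOn U a.toTetrad b.toTetrad) e e'

/-- On a neighbourhood of `p` there is a family of null frames, defined up to null rotations about
`ℓ` and spin-boosts (that is, a full orbit of these transformations), in all of which
`κ = ρ = σ = 0`. -/
def HasKundtFramesNear (g : LorentzMetric M) (p : M) : Prop :=
  ∃ U : Set M, IsOpen U ∧ p ∈ U ∧ ∃ F : Set (NullFrame g U), F.Nonempty ∧
    (∀ e ∈ F, ∀ e' : NullFrame g U, e' ∈ F ↔ SameFamily e e') ∧
    ∀ e ∈ F, KundtConditionsOn g U e.toTetrad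

end Metric

end Kundt

/-! Everything is read off the bilinear form `B(X, Y) = g(∇_X ℓ, Y)`. Write `m = a + i b`. The
orthogonal space of `ℓ` is spanned by `ℓ, a, b`, and `B(·, ℓ) = 0` because `ℓ` is null. The
remaining entries of `B` there are encoded by `κ` (first slot `ℓ`) and by `ρ, σ` (trace,
antisymmetric and trace-free symmetric parts on the span of `a, b`). So `κ = ρ = σ = 0` says exactly
that `B` vanishes on the orthogonal space of `ℓ` (`kundtConditionsOn_iff`). By the Leibniz rule this
property survives rescaling of `ℓ`, hence null rotations and spin-boosts.

For part 1, vanishing of `B` there makes `dω` a multiple of `ω`, so that `ω ∧ dω = 0`, and kills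
expansion and shear. Conversely, `ω ∧ dω = 0` tested on frame vectors gives `κ = 0` and `Im ρ = 0`;
expansion and shear give the rest (`kundtConditionsOn_of_isHypersurfaceOrthogonalOn`). A given null
field is completed to a null frame by a Gram–Schmidt construction
(`exists_nullFrame_of_isNullFieldOn`).

For part 2, the boost `A = exp u`, `w = exp (i θ)` turns `ε` into `exp u • (ε + (ℓ(u) + i ℓ(θ)) /
2)` (`epsilon_boostFrame`). Prescribing `ε` up to a positive factor therefore means solving two
equations `ℓ(u) = f`. These are locally solvable along a nonvanishing field by straightening it with
its flow (`exists_smooth_solution_dir`). Smooth dependence of the flow on time and initial point is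
obtained from the inverse function theorem in a space of continuous curves. -/

namespace Kundt

set_option linter.unusedSectionVars false

/-! ### Smooth local inverses and superposition operators on spaces of continuous maps -/

section Calculus

universe u

set_option synthInstance.maxHeartbeats 200000

/-- The inverse function theorem for a function which is smooth near a point: the local inverse is
smooth near the image point. -/
theorem exists_smooth_local_inverse {E F : Type*} [NormedAddCommGroup E] [NormedSpace ℝ E]
    [CompleteSpace E] [NormedAddCommGroup F] [NormedSpace ℝ F] {f : E → F} {f' : E ≃L[ℝ] F} {a : E}
    (hf : ∀ᶠ x in 𝓝 a, ContDiffAt ℝ ∞ f x) (hf' : HasFDerivAt f (f' : E →L[ℝ] F) a) :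
    ∃ h : F → E, h (f a) = a ∧ (∀ᶠ x in 𝓝 a, h (f x) = x) ∧
      ∀ᶠ y in 𝓝 (f a), f (h y) = y ∧ ContDiffAt ℝ ∞ h y := by
  have hfa := hf.self_of_nhds
  have hn : (∞ : WithTop ℕ∞) ≠ 0 := by simp
  set e := hfa.toOpenPartialHomeomorph f hf' hn with he
  have hae : a ∈ e.source := hfa.mem_toOpenPartialHomeomorph_source hf' hn
  have hfe : f a ∈ e.target := e.map_source hae
  have hfs : ∀ x, e x = f x := fun x ↦ rfl
  have hsa : e.symm (f a) = a := e.left_inv hae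
  refine ⟨e.symm, hsa, ?_, ?_⟩
  · filter_upwards [e.open_source.mem_nhds hae] with x hx using e.left_inv hx
  · have hcont : Filter.Tendsto e.symm (𝓝 (f a)) (𝓝 a) := by
      have := e.continuousAt_symm hfe
      rwa [ContinuousAt, hsa] at this
    -- Smoothness of the inverse at nearby points needs an invertible derivative there; invertible
    -- operators form an open set and the derivative is continuous.
    have hder : ∀ᶠ x in 𝓝 a, fderiv ℝ f x ∈ range
        (ContinuousLinearEquiv.toContinuousLinearMap : (E ≃L[ℝ] F) → E →L[ℝ] F) := by
      have hc : ContinuousAt (fderiv ℝ f) a :=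
        (hfa.fderiv_right (m := 0) (by simp)).continuousAt
      apply hc
      rw [hf'.fderiv]
      exact ContinuousLinearEquiv.nhds f'
    filter_upwards [e.open_target.mem_nhds hfe, hcont.eventually hf, hcont.eventually hder]
      with y hy hfy ⟨f'', hf''⟩
    refine ⟨e.right_inv hy, e.contDiffAt_symm (f₀' := f'') hy ?_ hfy⟩
    rw [hf'']
    exact (hfy.differentiableAt (by simp)).hasFDerivAt

variable {K : Type*} [TopologicalSpace K] [CompactSpace K]

/-- The superposition operator `γ ↦ F ∘ γ` on continuous functions on a compact space. -/
def superposition {E G : Type*} [TopologicalSpace E] [TopologicalSpace G] (F : C(E, G)) :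
    C(K, E) → C(K, G) := fun γ ↦ F.comp γ

/-- The pointwise extension of a bounded bilinear map to continuous functions. -/
noncomputable def pointwiseBilinear (K : Type*) [TopologicalSpace K] [CompactSpace K]
    {V E G : Type*} [NormedAddCommGroup V] [NormedSpace ℝ V]
    [NormedAddCommGroup E] [NormedSpace ℝ E] [NormedAddCommGroup G] [NormedSpace ℝ G]
    (b : V →L[ℝ] E →L[ℝ] G) : C(K, V) →L[ℝ] C(K, E) →L[ℝ] C(K, G) :=
  LinearMap.mkContinuous₂
    (LinearMap.mk₂ ℝ (fun (A : C(K, V)) (h : C(K, E)) ↦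
      (⟨fun t ↦ b (A t) (h t), by fun_prop⟩ : C(K, G)))
      (fun _ _ _ ↦ by ext; simp) (fun _ _ _ ↦ by ext; simp)
      (fun _ _ _ ↦ by ext; simp) (fun _ _ _ ↦ by ext; simp)) ‖b‖
    (fun A h ↦ by
      rw [ContinuousMap.norm_le _ (by positivity)]
      intro t
      simp only [LinearMap.mk₂_apply, ContinuousMap.coe_mk]
      exact (b.le_opNorm₂ _ _).trans (by gcongr <;> exact ContinuousMap.norm_coe_le_norm _ t))

@[simp] theorem pointwiseBilinear_apply {V E G : Type*} [NormedAddCommGroup V] [NormedSpace ℝ V]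
    [NormedAddCommGroup E] [NormedSpace ℝ E] [NormedAddCommGroup G] [NormedSpace ℝ G]
    (b : V →L[ℝ] E →L[ℝ] G) (A : C(K, V)) (h : C(K, E)) (t : K) :
    pointwiseBilinear K b A h t = b (A t) (h t) := rfl

/-- The pointwise first-order expansion of `F` holds uniformly along `γ`, by the mean value
inequality. No explicit uniform continuity of `F'` is needed: continuity of the superposition
operator of `F'` at `γ` already contains it. -/
theorem hasFDerivAt_superposition {E G : Type*} [NormedAddCommGroup E] [NormedSpace ℝ E]
    [NormedAddCommGroup G] [NormedSpace ℝ G] (F : C(E, G)) (F' : C(E, E →L[ℝ] G))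
    (hF : ∀ x, HasFDerivAt F (F' x) x) (γ : C(K, E)) :
    HasFDerivAt (superposition F : C(K, E) → C(K, G))
      (pointwiseBilinear K (.id ℝ (E →L[ℝ] G)) (superposition F' γ)) γ := by
  rw [hasFDerivAt_iff_isLittleO_nhds_zero, Asymptotics.isLittleO_iff]
  intro ε hε
  have hc : Continuous (superposition F' : C(K, E) → C(K, E →L[ℝ] G)) :=
    ContinuousMap.continuous_postcomp F'
  obtain ⟨δ, hδ, hδ'⟩ := Metric.continuousAt_iff (α := C(K, E)) (β := C(K, E →L[ℝ] G))
    |>.1 (hc.continuousAt (x := γ)) ε hε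
  filter_upwards [Metric.ball_mem_nhds (0 : C(K, E)) hδ] with h hh
  rw [mem_ball_zero_iff] at hh
  rw [ContinuousMap.norm_le _ (by positivity)]
  intro t
  have key := Convex.norm_image_sub_le_of_norm_hasFDerivWithin_le' (𝕜 := ℝ) (f := F) (C := ε)
    (s := Metric.closedBall (γ t) ‖h‖) (x := γ t) (y := γ t + h t) (f' := F') (φ := F' (γ t))
    (fun x _ ↦ (hF x).hasFDerivWithinAt) ?_ (convex_closedBall _ _) (by simp)
    (by simpa using h.norm_coe_le_norm t)
  · simp only [add_sub_cancel_left] at key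
    exact key.trans (mul_le_mul_of_nonneg_left (h.norm_coe_le_norm t) hε.le)
  · intro y hy
    -- The point `y` is realized as the value at `t` of a translate of `γ`, so that closeness of
    -- maps yields closeness of `F' y` to `F' (γ t)`.
    have h1 : dist (γ + ContinuousMap.const K (y - γ t)) γ < δ := by
      rw [dist_eq_norm, add_sub_cancel_left]
      refine lt_of_le_of_lt ?_ hh
      rw [ContinuousMap.norm_le _ (norm_nonneg _)]
      intro s
      simpa [dist_eq_norm] using hy
    have h2 := (ContinuousMap.dist_apply_le_dist t).trans (hδ' h1).le
    simpa [superposition, dist_eq_norm] using h2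

/-- The derivative of a superposition operator is again one, up to a bounded linear map, with `F`
replaced by its derivative. The target changes to a space of operators, so the induction runs over
all `G`, in the universe of `E`. -/
theorem contDiff_superposition_nat {E : Type u} [NormedAddCommGroup E] [NormedSpace ℝ E] (n : ℕ) :
    ∀ {G : Type u} [NormedAddCommGroup G] [NormedSpace ℝ G] (F : C(E, G)), ContDiff ℝ ∞ F →
      ContDiff ℝ n (superposition F : C(K, E) → C(K, G)) := by
  induction n with
  | zero =>
    intro G _ _ F _
    exact contDiff_zero.2 (ContinuousMap.continuous_postcomp F)
  | succ n ih =>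
    intro G _ _ F hF
    have hF' : ContDiff ℝ ∞ (fderiv ℝ F) := hF.fderiv_right (by simp)
    refine contDiff_succ_iff_hasFDerivAt.2 ⟨_, ?_, hasFDerivAt_superposition F
      ⟨fderiv ℝ F, hF'.continuous⟩ fun x ↦ (hF.differentiable (by simp) x).hasFDerivAt⟩
    exact (pointwiseBilinear K (.id ℝ (E →L[ℝ] G))).contDiff.comp
      (ih ⟨fderiv ℝ F, hF'.continuous⟩ hF')

theorem contDiff_superposition {E G : Type u} [NormedAddCommGroup E] [NormedSpace ℝ E]
    [NormedAddCommGroup G] [NormedSpace ℝ G] (F : C(E, G)) (hF : ContDiff ℝ ∞ F) :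
    ContDiff ℝ ∞ (superposition F : C(K, E) → C(K, G)) :=
  contDiff_infty.2 fun n ↦ contDiff_superposition_nat n F hF

end Calculus

/-! ### Smooth local flows and the equation `X(u) = f` in a vector space -/

section Flow

universe u

theorem continuous_iccExtend {E : Type*} [TopologicalSpace E] (γ : C(Icc (0 : ℝ) 1, E)) :
    Continuous (IccExtend zero_le_one γ : ℝ → E) :=
  γ.continuous.Icc_extend'

/-- The curve `r ↦ γ (t r)`. -/
def rescale {E : Type*} [TopologicalSpace E] (γ : C(Icc (0 : ℝ) 1, E))
    (t : Icc (0 : ℝ) 1) : C(Icc (0 : ℝ) 1, E) :=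
  ⟨fun r ↦ γ (t * r), by fun_prop⟩

@[simp] theorem rescale_apply {E : Type*} [TopologicalSpace E] (γ : C(Icc (0 : ℝ) 1, E))
    (t r : Icc (0 : ℝ) 1) :
    rescale γ t r = γ (t * r) := rfl

variable {E : Type u} [NormedAddCommGroup E] [NormedSpace ℝ E]

/-- The primitive `t ↦ ∫₀ᵗ γ` as an operator on continuous curves on `[0, 1]`. -/
noncomputable def primitiveMap (E : Type u) [NormedAddCommGroup E] [NormedSpace ℝ E] :
    C(Icc (0 : ℝ) 1, E) →L[ℝ] C(Icc (0 : ℝ) 1, E) :=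
  LinearMap.mkContinuous
    { toFun := fun γ ↦
        ⟨fun t ↦ ∫ r in (0 : ℝ)..t, IccExtend zero_le_one γ r,
          (intervalIntegral.continuous_primitive
            (fun a b ↦ (continuous_iccExtend γ).intervalIntegrable a b) 0).comp
            continuous_subtype_val⟩
      map_add' := fun γ γ' ↦ by
        ext t
        exact intervalIntegral.integral_add ((continuous_iccExtend γ).intervalIntegrable _ _)
          ((continuous_iccExtend γ').intervalIntegrable _ _)
      map_smul' := fun c γ ↦ by
        ext t
        exact intervalIntegral.integral_smul c _ } 1
    (fun γ ↦ by
      rw [ContinuousMap.norm_le _ (by positivity)]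
      intro t
      refine (intervalIntegral.norm_integral_le_of_norm_le_const (C := ‖γ‖)
        fun r _ ↦ γ.norm_coe_le_norm _).trans ?_
      have h0 := t.2.1
      have h1 := t.2.2
      rw [sub_zero, abs_of_nonneg h0, one_mul]
      exact mul_le_of_le_one_right (norm_nonneg _) h1)

theorem primitiveMap_apply (γ : C(Icc (0 : ℝ) 1, E)) (t : Icc (0 : ℝ) 1) :
    primitiveMap E γ t = ∫ r in (0 : ℝ)..t, IccExtend zero_le_one γ r := rfl

/-- The constant curve, as an operator. -/
noncomputable def constCurve (E : Type u) [NormedAddCommGroup E] [NormedSpace ℝ E] :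
    E →L[ℝ] C(Icc (0 : ℝ) 1, E) :=
  LinearMap.mkContinuous
    { toFun := fun x ↦ ContinuousMap.const _ x
      map_add' := fun _ _ ↦ by ext; simp
      map_smul' := fun _ _ ↦ by ext; simp } 1
    (fun x ↦ by
      rw [ContinuousMap.norm_le _ (by positivity)]
      intro t
      simp)

@[simp] theorem constCurve_apply (x : E) (t : Icc (0 : ℝ) 1) : constCurve E x t = x := rfl

theorem primitiveMap_rescale (γ : C(Icc (0 : ℝ) 1, E)) (t r : Icc (0 : ℝ) 1) :
    (t : ℝ) • primitiveMap E (rescale γ t) r = primitiveMap E γ (t * r) := by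
  rw [primitiveMap_apply, primitiveMap_apply]
  have h : ∫ x in (0 : ℝ)..r, IccExtend zero_le_one (rescale γ t) x
      = ∫ x in (0 : ℝ)..r, IccExtend zero_le_one γ (t * x) := by
    refine intervalIntegral.integral_congr fun x hx ↦ ?_
    rw [uIcc_of_le r.2.1] at hx
    have hx' : x ∈ Icc (0 : ℝ) 1 := ⟨hx.1, hx.2.trans r.2.2⟩
    have htx : (t : ℝ) * x ∈ Icc (0 : ℝ) 1 := (t * ⟨x, hx'⟩ : Icc (0 : ℝ) 1).2
    rw [IccExtend_of_mem _ _ hx', IccExtend_of_mem _ _ htx]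
    rfl
  rw [h, intervalIntegral.smul_integral_comp_mul_left]
  simp

/-- The map `(s, x, γ) ↦ (s, x, γ - x - s ∫ F ∘ γ)`, whose zeros in the last component are the
integral curves of `s F` starting at `x`. -/
noncomputable def flowEquation (F : C(E, E)) (p : ℝ × E × C(Icc (0 : ℝ) 1, E)) :
    ℝ × E × C(Icc (0 : ℝ) 1, E) :=
  (p.1, p.2.1, p.2.2 - constCurve E p.2.1 - p.1 • primitiveMap E (superposition F p.2.2))

theorem contDiff_flowEquation (F : C(E, E)) (hF : ContDiff ℝ ∞ F) :
    ContDiff ℝ ∞ (flowEquation F) := by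
  have h1 : ContDiff ℝ ∞ fun p : ℝ × E × C(Icc (0 : ℝ) 1, E) ↦
      primitiveMap E (superposition F p.2.2) :=
    (primitiveMap E).contDiff.comp ((contDiff_superposition F hF).comp contDiff_snd.snd)
  have h2 : ContDiff ℝ ∞ fun p : ℝ × E × C(Icc (0 : ℝ) 1, E) ↦ constCurve E p.2.1 :=
    (constCurve E).contDiff.comp contDiff_snd.fst
  exact contDiff_fst.prodMk (contDiff_snd.fst.prodMk
    ((contDiff_snd.snd.sub h2).sub (contDiff_fst.smul h1)))

/-- The linear isomorphism `(s, x, h) ↦ (s, x, h - x - s c)`. -/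
noncomputable def shearEquiv (c : C(Icc (0 : ℝ) 1, E)) :
    (ℝ × E × C(Icc (0 : ℝ) 1, E)) ≃L[ℝ] ℝ × E × C(Icc (0 : ℝ) 1, E) :=
  ContinuousLinearEquiv.equivOfInverse
    ((ContinuousLinearMap.fst ℝ _ _).prod (((ContinuousLinearMap.fst ℝ _ _).comp
      (ContinuousLinearMap.snd ℝ _ _)).prod
      ((ContinuousLinearMap.snd ℝ _ _).comp (ContinuousLinearMap.snd ℝ _ _)
        - (constCurve E).comp ((ContinuousLinearMap.fst ℝ _ _).comp (ContinuousLinearMap.snd ℝ _ _))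
        - (ContinuousLinearMap.fst ℝ _ _).smulRight c)))
    ((ContinuousLinearMap.fst ℝ _ _).prod (((ContinuousLinearMap.fst ℝ _ _).comp
      (ContinuousLinearMap.snd ℝ _ _)).prod
      ((ContinuousLinearMap.snd ℝ _ _).comp (ContinuousLinearMap.snd ℝ _ _)
        + (constCurve E).comp ((ContinuousLinearMap.fst ℝ _ _).comp (ContinuousLinearMap.snd ℝ _ _))
        + (ContinuousLinearMap.fst ℝ _ _).smulRight c)))
    (fun p ↦ by
      ext <;> (simp; try abel))
    (fun p ↦ by
      ext <;> (simp; try abel))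

theorem shearEquiv_apply (c : C(Icc (0 : ℝ) 1, E)) (p : ℝ × E × C(Icc (0 : ℝ) 1, E)) :
    shearEquiv c p = (p.1, p.2.1, p.2.2 - constCurve E p.2.1 - p.1 • c) := rfl

/-- At `s = 0` the product rule leaves only the `ds` part of `s ∫ F ∘ γ`: the derivative of the
superposition is multiplied by `0`. The linearization is thus triangular and visibly invertible. -/
theorem hasFDerivAt_flowEquation (F : C(E, E)) (hF : ContDiff ℝ ∞ F) (x₀ : E) :
    HasFDerivAt (flowEquation F)
      (shearEquiv (primitiveMap E (superposition F (constCurve E x₀))) :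
        (ℝ × E × C(Icc (0 : ℝ) 1, E)) →L[ℝ] ℝ × E × C(Icc (0 : ℝ) 1, E))
      (0, x₀, constCurve E x₀) := by
  have h1 : ContDiff ℝ ∞ fun p : ℝ × E × C(Icc (0 : ℝ) 1, E) ↦
      primitiveMap E (superposition F p.2.2) :=
    (primitiveMap E).contDiff.comp ((contDiff_superposition F hF).comp contDiff_snd.snd)
  have h2 : ∀ a, HasFDerivAt (fun p : ℝ × E × C(Icc (0 : ℝ) 1, E) ↦
      primitiveMap E (superposition F p.2.2)) _ a :=
    fun a ↦ (h1.differentiable (by simp) a).hasFDerivAt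
  have hs := hasFDerivAt_fst (𝕜 := ℝ) (p := ((0 : ℝ), x₀, constCurve E x₀))
  have ht := hasFDerivAt_snd (𝕜 := ℝ) (p := ((0 : ℝ), x₀, constCurve E x₀))
  have := hs.prodMk (ht.fst.prodMk
    ((ht.snd.sub ((constCurve E).hasFDerivAt.comp _ ht.fst)).sub (hs.smul (h2 _))))
  refine this.congr_fderiv ?_
  ext p
  · simp [shearEquiv_apply]
  · simp [shearEquiv_apply]
  · simp [shearEquiv_apply]
  all_goals simp [shearEquiv_apply]

/-- Uniqueness of solutions is known only inside this ball; rescaling by `t ≤ 1` shrinks the speed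
and takes no new values of the curve, so it does not leave the ball. -/
theorem rescale_mem_ball {a : ℝ × E × C(Icc (0 : ℝ) 1, E)} {x : E} {r : ℝ}
    (ha : a = (0, x, constCurve E x))
    (hr : 0 < r) {s : ℝ} {y : E} {γ : C(Icc (0 : ℝ) 1, E)} (h : (s, y, γ) ∈ Metric.ball a r)
    (t : Icc (0 : ℝ) 1) : ((t : ℝ) * s, y, rescale γ t) ∈ Metric.ball a r := by
  simp only [ha, Metric.mem_ball, Prod.dist_eq, max_lt_iff] at h ⊢
  refine ⟨?_, h.2.1, ?_⟩
  · refine lt_of_le_of_lt ?_ h.1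
    simp only [dist_zero_right, norm_mul, Real.norm_eq_abs, abs_of_nonneg t.2.1]
    exact mul_le_of_le_one_left (abs_nonneg _) t.2.2
  · rw [ContinuousMap.dist_lt_iff hr]
    intro s
    exact (ContinuousMap.dist_apply_le_dist (t * s)).trans_lt h.2.2

/-- If `γ` runs with speed `s`, then `γ (t ·)` runs with speed `t s`. Together with local
injectivity of `flowEquation` this gives the scaling law of the solution family. -/
theorem flowEquation_rescale (F : C(E, E)) {s : ℝ} {y : E} {γ : C(Icc (0 : ℝ) 1, E)}
    (h : γ = constCurve E y + s • primitiveMap E (superposition F γ)) (t : Icc (0 : ℝ) 1) :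
    flowEquation F ((t : ℝ) * s, y, rescale γ t) = (t * s, y, 0) := by
  refine Prod.ext rfl (Prod.ext rfl ?_)
  ext r
  have h3 : superposition F (rescale γ t) = rescale (superposition F γ) t := rfl
  have h4 : γ (t * r) = y + s • primitiveMap E (superposition F γ) (t * r) :=
    DFunLike.congr_fun h (t * r)
  change γ (t * r) - y - ((t : ℝ) * s) • primitiveMap E (superposition F (rescale γ t)) r = 0
  rw [mul_comm (t : ℝ) s, mul_smul, h3, primitiveMap_rescale, h4]
  simp

/-- The integral curves of `s F` on `[0, 1]` depend smoothly on `s` and on the initial point. -/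
theorem exists_smooth_integral_curves [CompleteSpace E] (F : C(E, E)) (hF : ContDiff ℝ ∞ F)
    (x₀ : E) : ∃ γ : ℝ × E → C(Icc (0 : ℝ) 1, E), ∀ᶠ p in 𝓝 ((0 : ℝ), x₀), ContDiffAt ℝ ∞ γ p ∧
      γ p = constCurve E p.2 + p.1 • primitiveMap E (superposition F (γ p)) ∧
      ∀ t : Icc (0 : ℝ) 1, γ (t * p.1, p.2) = rescale (γ p) t := by
  set a : ℝ × E × C(Icc (0 : ℝ) 1, E) := (0, x₀, constCurve E x₀) with ha
  have hHa : flowEquation F a = (0, x₀, 0) := by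
    simp [flowEquation, ha]
  obtain ⟨h, hha, hleft, hright⟩ := exists_smooth_local_inverse
    (Filter.Eventually.of_forall fun p ↦ (contDiff_flowEquation F hF).contDiffAt)
    (hasFDerivAt_flowEquation F hF x₀)
  rw [← ha, hHa] at hha hright
  obtain ⟨r, hr, hball⟩ := Metric.eventually_nhds_iff_ball.1 hleft
  have hι : ContDiff ℝ ∞ fun p : ℝ × E ↦ ((p.1, p.2, 0) : ℝ × E × C(Icc (0 : ℝ) 1, E)) := by
    fun_prop
  have hιt : Filter.Tendsto (fun p : ℝ × E ↦ ((p.1, p.2, 0) : ℝ × E × C(Icc (0 : ℝ) 1, E)))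
      (𝓝 (0, x₀)) (𝓝 (0, x₀, 0)) := hι.continuous.tendsto (0, x₀)
  have hcont : Filter.Tendsto h (𝓝 (0, x₀, 0)) (𝓝 a) := by
    have := hright.self_of_nhds.2.continuousAt
    rwa [ContinuousAt, hha] at this
  set γ : ℝ × E → C(Icc (0 : ℝ) 1, E) := fun p ↦ (h (p.1, p.2, 0)).2.2 with hγ
  -- the curves `γ p` solve the integral equation
  have hsol : ∀ᶠ p in 𝓝 ((0 : ℝ), x₀), (p.1, p.2, γ p) ∈ Metric.ball a r ∧
      ContDiffAt ℝ ∞ γ p ∧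
      γ p = constCurve E p.2 + p.1 • primitiveMap E (superposition F (γ p)) := by
    filter_upwards [hιt.eventually hright,
      hιt.eventually (hcont.eventually (Metric.ball_mem_nhds a hr))] with p hp hpr
    have he : h (p.1, p.2, 0) = (p.1, p.2, γ p) := by
      have h1 := hp.1
      simp only [flowEquation, Prod.mk.injEq] at h1
      exact Prod.ext h1.1 (Prod.ext h1.2.1 rfl)
    refine ⟨he ▸ hpr, (hp.2.comp p hι.contDiffAt).snd.snd, ?_⟩
    have h1 := hp.1
    rw [he] at h1
    simp only [flowEquation, Prod.mk.injEq] at h1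
    have h2 := h1.2.2
    rw [sub_sub, sub_eq_zero] at h2
    exact h2
  refine ⟨γ, ?_⟩
  filter_upwards [hsol] with p ⟨hp, hps, hpe⟩
  refine ⟨hps, hpe, fun t ↦ ?_⟩
  -- The rescaled curve and the solution with parameter `t s` have the same image under
  -- `flowEquation`; the left inverse on the ball identifies them.
  have h5 := hball _ (rescale_mem_ball ha hr hp t)
  rw [flowEquation_rescale F hpe] at h5
  exact congrArg (fun q ↦ q.2.2) h5

/-- A smooth vector field has a smooth local flow. -/
theorem exists_smooth_local_flow [CompleteSpace E] (F : C(E, E)) (hF : ContDiff ℝ ∞ F) (x₀ : E) :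
    ∃ φ : ℝ × E → E, ∀ᶠ p in 𝓝 ((0 : ℝ), x₀), ContDiffAt ℝ ∞ φ p ∧ φ (0, p.2) = p.2 ∧
      HasDerivAt (fun s ↦ φ (s, p.2)) (F (φ p)) p.1 := by
  obtain ⟨γ, hsol⟩ := exists_smooth_integral_curves F hF x₀
  -- The flow at time `s` is the endpoint of the integral curve of `s F`.
  set e₁ : Icc (0 : ℝ) 1 := ⟨1, by simp⟩ with he₁
  set φ : ℝ × E → E := fun p ↦ γ p e₁ with hφ
  have hφs : ∀ᶠ p in 𝓝 ((0 : ℝ), x₀), ContDiffAt ℝ ∞ φ p := by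
    filter_upwards [hsol] with p hp
    exact (ContinuousMap.evalCLM ℝ e₁ : C(Icc (0 : ℝ) 1, E) →L[ℝ] E).contDiff.contDiffAt.comp p
      hp.1
  have hline : ∀ p, ContDiffAt ℝ ∞ φ p →
      HasDerivAt (fun s ↦ φ (s, p.2)) (fderiv ℝ φ p (1, 0)) p.1 := by
    intro p hp
    have h1 : HasFDerivAt φ (fderiv ℝ φ p) (p.1, p.2) :=
      (hp.differentiableAt (by simp)).hasFDerivAt
    exact h1.comp_hasDerivAt p.1 ((hasDerivAt_id p.1).prodMk (hasDerivAt_const p.1 p.2))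
  -- The curve `t ↦ φ (t s, x)` is differentiated at `t = 1` twice, by the chain rule and by the
  -- integral equation, and the factor `s` is cancelled. Only a one-sided derivative is available
  -- because `t` stays in `[0, 1]`.
  have hne : ∀ᶠ p in 𝓝 ((0 : ℝ), x₀), p.1 ≠ 0 → fderiv ℝ φ p (1, 0) = F (φ p) := by
    filter_upwards [hsol, hφs] with p ⟨_, hpe, hpr⟩ hps hp0
    have h1 : HasDerivWithinAt (fun t : ℝ ↦ φ (t * p.1, p.2)) (p.1 • fderiv ℝ φ p (1, 0))
        (Icc 0 1) 1 := by
      have h2 := hline p hps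
      have h3 : HasDerivAt (fun t : ℝ ↦ t * p.1) p.1 1 := by
        simpa using (hasDerivAt_id (1 : ℝ)).mul_const p.1
      have h4 := HasDerivAt.scomp (x := (1 : ℝ)) (h := fun t : ℝ ↦ t * p.1)
        (g₁ := fun s ↦ φ (s, p.2)) (by simpa using h2) h3
      exact h4.hasDerivWithinAt
    have h5 : HasDerivWithinAt (fun t : ℝ ↦ φ (t * p.1, p.2)) (p.1 • F (φ p)) (Icc 0 1) 1 := by
      have h6 : HasDerivAt (fun t : ℝ ↦ p.2 + p.1 •
          ∫ s in (0 : ℝ)..t, IccExtend zero_le_one (superposition F (γ p)) s)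
          (p.1 • F (φ p)) 1 := by
        have hc := continuous_iccExtend (superposition F (γ p))
        have h7 := (intervalIntegral.integral_hasDerivAt_right
          (hc.intervalIntegrable 0 1) (hc.stronglyMeasurableAtFilter _ _) hc.continuousAt)
        rw [IccExtend_of_mem _ _ (by simp)] at h7
        exact (h7.const_smul p.1).const_add p.2
      refine h6.hasDerivWithinAt.congr_of_mem (fun t ht ↦ ?_) (by simp)
      have h8 := DFunLike.congr_fun (hpr ⟨t, ht⟩) e₁
      have h9 := DFunLike.congr_fun hpe ⟨t, ht⟩
      rw [hφ]
      simp only at h8 ⊢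
      rw [h8, rescale_apply]
      have h10 : (⟨t, ht⟩ : Icc (0 : ℝ) 1) * e₁ = ⟨t, ht⟩ := Subtype.ext (mul_one t)
      rw [h10, h9]
      simp [primitiveMap_apply]
    have h11 := (uniqueDiffOn_Icc_zero_one 1 (by simp)).eq_deriv _ h1 h5
    exact smul_right_injective E hp0 h11
  refine ⟨φ, ?_⟩
  have hne' := hne.eventually_nhds
  have hzero : ∀ᶠ p in 𝓝 ((0 : ℝ), x₀), φ (0, p.2) = p.2 := by
    have ht : Filter.Tendsto (fun p : ℝ × E ↦ ((0 : ℝ), p.2)) (𝓝 (0, x₀)) (𝓝 (0, x₀)) :=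
      (continuous_const.prodMk continuous_snd).tendsto _
    filter_upwards [ht.eventually hsol] with p ⟨_, hp, _⟩
    have := DFunLike.congr_fun hp e₁
    simpa using this
  filter_upwards [hφs, hne', hzero] with p hps hpe hp0
  refine ⟨hps, hp0, ?_⟩
  suffices h : fderiv ℝ φ p (1, 0) = F (φ p) from h ▸ hline p hps
  by_cases hp : p.1 = 0
  swap
  · exact hpe.self_of_nhds hp
  -- At `s = 0` the factor cannot be cancelled; both sides are continuous, so the identity passes to
  -- the limit from `s ≠ 0`.
  have ht : Filter.Tendsto (fun s : ℝ ↦ (s, p.2)) (𝓝[≠] p.1) (𝓝 p) :=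
    ((continuous_id.prodMk continuous_const).tendsto' _ _ rfl).mono_left nhdsWithin_le_nhds
  have hd : Filter.Tendsto (fun q ↦ fderiv ℝ φ q (1, 0)) (𝓝 p) (𝓝 (fderiv ℝ φ p (1, 0))) :=
    ((hps.fderiv_right (m := 0) (by simp)).continuousAt.clm_apply continuousAt_const)
  have hf : Filter.Tendsto (fun q ↦ F (φ q)) (𝓝 p) (𝓝 (F (φ p))) :=
    hF.continuous.continuousAt.comp hps.continuousAt
  refine tendsto_nhds_unique_of_eventuallyEq (hd.comp ht) (hf.comp ht) ?_
  filter_upwards [ht.eventually hpe, self_mem_nhdsWithin] with s hs hs'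
  exact hs (by simpa [hp] using hs')

/-- A function which is smooth near a point agrees near this point with a globally smooth one. -/
theorem exists_contDiff_eventuallyEq {G : Type*} [NormedAddCommGroup G] [NormedSpace ℝ G]
    [FiniteDimensional ℝ E] {f : E → G} {x₀ : E} (hf : ∀ᶠ x in 𝓝 x₀, ContDiffAt ℝ ∞ f x) :
    ∃ f' : E → G, ContDiff ℝ ∞ f' ∧ f' =ᶠ[𝓝 x₀] f := by
  obtain ⟨r, hr, hball⟩ := Metric.eventually_nhds_iff_ball.1 hf
  -- The outer radius `r / 2` keeps the support of the cutoff inside the ball where `f` is smooth.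
  let b : ContDiffBump x₀ := ⟨r / 4, r / 2, by positivity, by linarith⟩
  refine ⟨fun x ↦ b x • f x, contDiff_iff_contDiffAt.2 fun x ↦ ?_, ?_⟩
  · by_cases hx : x ∈ Metric.ball x₀ r
    · exact b.contDiff.contDiffAt.smul (hball x hx)
    · have h : x ∉ tsupport b := by
        rw [b.tsupport_eq]
        simp only [Metric.mem_ball, Metric.mem_closedBall, not_lt, not_le] at hx ⊢
        exact lt_of_lt_of_le (by change r / 2 < r; linarith) hx
      have h' := notMem_tsupport_iff_eventuallyEq.1 h
      refine (contDiffAt_const (c := (0 : G))).congr_of_eventuallyEq ?_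
      filter_upwards [h'] with y hy
      simp [hy]
  · filter_upwards [b.eventuallyEq_one] with x hx
    simp [hx]

/-- The equation `X(u) = f` for smooth `X, f` is locally solvable where `X` does not vanish. -/
theorem exists_smooth_solution_fderiv [FiniteDimensional ℝ E] {X : E → E} {f : E → ℝ} {x₀ : E}
    (hX : ∀ᶠ x in 𝓝 x₀, ContDiffAt ℝ ∞ X x) (hf : ∀ᶠ x in 𝓝 x₀, ContDiffAt ℝ ∞ f x)
    (h0 : X x₀ ≠ 0) :
    ∃ u : E → ℝ, ∀ᶠ x in 𝓝 x₀, ContDiffAt ℝ ∞ u x ∧ fderiv ℝ u x (X x) = f x := by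
  have : CompleteSpace E := FiniteDimensional.complete ℝ E
  obtain ⟨X', hX', hXX⟩ := exists_contDiff_eventuallyEq hX
  obtain ⟨f', hf', hff⟩ := exists_contDiff_eventuallyEq hf
  set v := X' x₀ with hv
  have hv0 : v ≠ 0 := by rwa [hv, hXX.self_of_nhds]
  obtain ⟨l, hl⟩ := SeparatingDual.exists_eq_one (R := ℝ) hv0
  -- Flowing along `(X, f)` on `E × ℝ`, the last coordinate accumulates the integral of `f` along
  -- the integral curves of `X`.
  have hF : ContDiff ℝ ∞ fun p : E × ℝ ↦ ((X' p.1, f' p.1) : E × ℝ) :=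
    (hX'.comp contDiff_fst).prodMk (hf'.comp contDiff_fst)
  obtain ⟨φ, hφ⟩ := exists_smooth_local_flow ⟨_, hF.continuous⟩ hF (x₀, (0 : ℝ))
  -- `l z` is the time and `x₀ + z - l z • v` the initial point on the transversal `l = l x₀`
  set A : E → ℝ × (E × ℝ) := fun z ↦ (l z, (x₀ + z - l z • v, 0)) with hA
  have hAs : ContDiff ℝ ∞ A := by
    have := l.contDiff (n := ∞)
    fun_prop
  have hA0 : A 0 = (0, (x₀, 0)) := by simp [hA]
  have hAt : Filter.Tendsto A (𝓝 0) (𝓝 (0, (x₀, 0))) := hA0 ▸ hAs.continuous.tendsto 0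
  -- Since `l v = 1`, moving `z` along `v` advances the time and fixes the initial point; hence `Ψ`
  -- carries the constant field `v` to `X'`.
  have hAl : ∀ z t, A (z + t • v) = (l z + t, (A z).2) := by
    intro z t
    simp only [hA, map_add, map_smul, hl, smul_eq_mul, mul_one, add_smul]
    congr 2
    abel
  set Ψ : E → E := fun z ↦ (φ (A z)).1 with hΨ
  set α : E → ℝ := fun z ↦ (φ (A z)).2 with hα
  have hs : ∀ᶠ z in 𝓝 (0 : E), ContDiffAt ℝ ∞ Ψ z ∧ ContDiffAt ℝ ∞ α z ∧
      fderiv ℝ Ψ z v = X' (Ψ z) ∧ fderiv ℝ α z v = f' (Ψ z) := by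
    filter_upwards [hAt.eventually hφ] with z ⟨hz, _, hzd⟩
    have hz' := hz.comp z hAs.contDiffAt
    have h1 : ContDiffAt ℝ ∞ Ψ z := hz'.fst
    have h2 : ContDiffAt ℝ ∞ α z := hz'.snd
    have hline : HasDerivAt (fun t : ℝ ↦ z + t • v) v 0 := by
      simpa using ((hasDerivAt_id (0 : ℝ)).smul_const v).const_add z
    have hd : HasDerivAt (fun t : ℝ ↦ φ (A (z + t • v))) (X' (Ψ z), f' (Ψ z)) 0 := by
      simp only [hAl]
      have := HasDerivAt.comp_const_add (l z) (0 : ℝ) (f := fun s ↦ φ (s, (A z).2))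
        (by simpa using hzd)
      exact this
    have hz0 : z + (0 : ℝ) • v = z := by simp
    have h3 : HasFDerivAt Ψ (fderiv ℝ Ψ z) (z + (0 : ℝ) • v) :=
      hz0.symm ▸ (h1.differentiableAt (by simp)).hasFDerivAt
    have h4 : HasFDerivAt α (fderiv ℝ α z) (z + (0 : ℝ) • v) :=
      hz0.symm ▸ (h2.differentiableAt (by simp)).hasFDerivAt
    exact ⟨h1, h2, (h3.comp_hasDerivAt 0 hline).unique
        ((ContinuousLinearMap.fst ℝ E ℝ).hasFDerivAt.comp_hasDerivAt 0 hd),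
      (h4.comp_hasDerivAt 0 hline).unique
        ((ContinuousLinearMap.snd ℝ E ℝ).hasFDerivAt.comp_hasDerivAt 0 hd)⟩
  have htrans : ∀ᶠ z in 𝓝 (0 : E), l z = 0 → Ψ z = x₀ + z := by
    filter_upwards [hAt.eventually hφ] with z ⟨_, hz, _⟩ hlz
    have h1 : A z = (0, (A z).2) := by simp [hA, hlz]
    rw [hΨ]
    simp only
    rw [h1, hz]
    simp [hA, hlz]
  have hΨ0 : Ψ 0 = x₀ := by simpa using htrans.self_of_nhds (by simp)
  -- On the hyperplane `l = 0` the map `Ψ` is a translation, and in the transversal direction its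
  -- derivative at `0` sends `v` to `X' x₀ = v`; so the derivative is the identity.
  have hΨd : HasFDerivAt Ψ ((ContinuousLinearEquiv.refl ℝ E : E ≃L[ℝ] E) : E →L[ℝ] E) 0 := by
    obtain ⟨h1, _, h2, _⟩ := hs.self_of_nhds
    have h3 := (h1.differentiableAt (by simp)).hasFDerivAt
    refine h3.congr_fderiv ?_
    ext w
    have hw : fderiv ℝ Ψ 0 (w - l w • v) = w - l w • v := by
      set w' := w - l w • v
      have hlw : l w' = 0 := by simp [w', hl]
      have hline : HasDerivAt (fun t : ℝ ↦ t • w') w' 0 := by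
        simpa using (hasDerivAt_id (0 : ℝ)).smul_const w'
      have h4 : HasFDerivAt Ψ (fderiv ℝ Ψ 0) ((0 : ℝ) • w') := by simpa using h3
      refine (h4.comp_hasDerivAt 0 hline).unique ?_
      refine (hline.const_add x₀).congr_of_eventuallyEq ?_
      have ht : Filter.Tendsto (fun t : ℝ ↦ t • w') (𝓝 0) (𝓝 0) := by
        simpa using hline.continuousAt.tendsto
      filter_upwards [ht.eventually htrans] with t ht
      exact ht (by simp [hlw])
    have h5 : w = (w - l w • v) + l w • v := by abel
    conv_lhs => rw [h5]
    rw [map_add, hw, map_smul, h2, hΨ0, ← hv]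
    simp
  obtain ⟨h, hh0, hleft, hright⟩ := exists_smooth_local_inverse (hs.mono fun z hz ↦ hz.1) hΨd
  rw [hΨ0] at hh0 hright
  have hht : Filter.Tendsto h (𝓝 x₀) (𝓝 0) := by
    have := hright.self_of_nhds.2.continuousAt
    rwa [ContinuousAt, hh0] at this
  -- The solution is `α` in straightened coordinates. Differentiating `α = u ∘ Ψ` along `v` gives
  -- `du(X) = f` without computing the derivative of `h`.
  refine ⟨α ∘ h, ?_⟩
  filter_upwards [hright, hht.eventually hs, hht.eventually hleft.eventually_nhds, hXX, hff]
    with x ⟨hx, hhx⟩ ⟨hΨx, hαx, hΨv, hαv⟩ hl' hXx hfx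
  have hu : ContDiffAt ℝ ∞ (α ∘ h) x := hαx.comp x hhx
  refine ⟨hu, ?_⟩
  have h1 : α =ᶠ[𝓝 (h x)] (α ∘ h) ∘ Ψ := by
    filter_upwards [hl'] with z hz
    simp [hz]
  have h2 : fderiv ℝ α (h x) = (fderiv ℝ (α ∘ h) x).comp (fderiv ℝ Ψ (h x)) := by
    rw [h1.fderiv_eq, fderiv_comp _ _ (hΨx.differentiableAt (by simp)), hx]
    rw [hx]
    exact hu.differentiableAt (by simp)
  have h3 := DFunLike.congr_fun h2 v
  rw [ContinuousLinearMap.comp_apply, hΨv, hαv, hx, hXx, hfx] at h3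
  exact h3.symm

end Flow

/-! ### Calculus of the Levi-Civita connection from the Koszul formula -/

section Connection

variable {M : Type*} [TopologicalSpace M] [ChartedSpace (EuclideanSpace ℝ (Fin 4)) M]
  [IsManifold (𝓡 4) ∞ M] {g : LorentzMetric M} {p : M}

/-- The vector field `X` is differentiable at `p`. -/
abbrev DiffFieldAt (X : VField M) (p : M) : Prop :=
  MDifferentiableAt (𝓡 4) (𝓡 4).tangent (fun q ↦ (⟨q, X q⟩ : TangentBundle (𝓡 4) M)) p

/-- The function `f` is differentiable at `p`. -/
abbrev DiffAt (f : M → ℝ) (p : M) : Prop := MDifferentiableAt (𝓡 4) 𝓘(ℝ, ℝ) f p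

theorem SmoothFieldAt.diff {X : VField M} (h : SmoothFieldAt X p) : DiffFieldAt X p :=
  ContMDiffAt.mdifferentiableAt h (by simp)

theorem SmoothFieldAt.pair {X Y : VField M} (hX : SmoothFieldAt X p) (hY : SmoothFieldAt Y p) :
    ContMDiffAt (𝓡 4) 𝓘(ℝ, ℝ) ∞ (g.pair X Y) p := by
  have h := ContMDiffAt.clm_bundle_apply₂ (F₁ := EuclideanSpace ℝ (Fin 4))
    (F₂ := EuclideanSpace ℝ (Fin 4)) (F₃ := ℝ) (E₃ := fun _ : M ↦ ℝ) (g.contMDiff p) hX hY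
  rw [Bundle.contMDiffAt_section] at h
  exact h

theorem DiffFieldAt.pair {X Y : VField M} (hX : DiffFieldAt X p) (hY : DiffFieldAt Y p) :
    DiffAt (g.pair X Y) p := by
  have h := MDifferentiableAt.clm_bundle_apply₂ (F₁ := EuclideanSpace ℝ (Fin 4))
    (F₂ := EuclideanSpace ℝ (Fin 4)) (F₃ := ℝ) (E₃ := fun _ : M ↦ ℝ)
    ((g.contMDiff p).mdifferentiableAt (by simp)) hX hY
  rw [mdifferentiableAt_section] at h
  exact h

theorem pair_comm (X Y : VField M) : g.pair X Y = g.pair Y X := funext fun q ↦ g.symm q _ _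

theorem pair_add_left (X X' Y : VField M) : g.pair (X + X') Y = g.pair X Y + g.pair X' Y := by
  ext q; simp [LorentzMetric.pair]

theorem pair_add_right (X Y Y' : VField M) : g.pair X (Y + Y') = g.pair X Y + g.pair X Y' := by
  ext q; simp [LorentzMetric.pair]

theorem pair_smul_left (f : M → ℝ) (X Y : VField M) : g.pair (f • X) Y = f * g.pair X Y := by
  ext q; simp [LorentzMetric.pair]

theorem pair_smul_right (f : M → ℝ) (X Y : VField M) : g.pair X (f • Y) = f * g.pair X Y := by
  ext q; simp [LorentzMetric.pair]

theorem dir_add {X : VField M} {f f' : M → ℝ} (hf : DiffAt f p) (hf' : DiffAt f' p) :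
    dir X (f + f') p = dir X f p + dir X f' p := by
  simp [dir, mvfderiv_add hf hf']

theorem dir_mul {X : VField M} {f f' : M → ℝ} (hf : DiffAt f p) (hf' : DiffAt f' p) :
    dir X (f * f') p = f p * dir X f' p + f' p * dir X f p := by
  simp [dir, mvfderiv_mul hf hf']

theorem dir_add_left (X X' : VField M) (f : M → ℝ) :
    dir (X + X') f p = dir X f p + dir X' f p := by
  simp [dir]

theorem dir_smul_left (a : M → ℝ) (X : VField M) (f : M → ℝ) :
    dir (a • X) f p = a p * dir X f p := by
  simp [dir]

theorem dir_congr {X X' : VField M} {f f' : M → ℝ} (hX : X p = X' p) (hf : f =ᶠ[𝓝 p] f') :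
    dir X f p = dir X' f' p := by
  have h : mvfderiv (𝓡 4) f p = mvfderiv (𝓡 4) f' p := by
    ext v
    change (mfderiv (𝓡 4) 𝓘(ℝ, ℝ) f p v : ℝ) = mfderiv (𝓡 4) 𝓘(ℝ, ℝ) f' p v
    exact DFunLike.congr_fun hf.mfderiv_eq v
  simp only [dir, h, hX]

theorem bracket_swap (X Y : VField M) : bracket X Y p = - bracket Y X p :=
  VectorField.mlieBracket_swap_apply

theorem bracket_smul_right {X Y : VField M} {f : M → ℝ} (hf : DiffAt f p) (hY : DiffFieldAt Y p) :
    bracket X (f • Y) p = dir X f p • Y p + f p • bracket X Y p :=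
  VectorField.mlieBracket_smul_right hf hY

theorem bracket_smul_left {X Y : VField M} {f : M → ℝ} (hf : DiffAt f p) (hX : DiffFieldAt X p) :
    bracket (f • X) Y p = - (dir Y f p) • X p + f p • bracket X Y p :=
  VectorField.mlieBracket_smul_left hf hX

theorem bracket_add_left {X X' Y : VField M} (hX : DiffFieldAt X p) (hX' : DiffFieldAt X' p) :
    bracket (X + X') Y p = bracket X Y p + bracket X' Y p :=
  VectorField.mlieBracket_add_left hX hX'

theorem bracket_add_right {X Y Y' : VField M} (hY : DiffFieldAt Y p) (hY' : DiffFieldAt Y' p) :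
    bracket X (Y + Y') p = bracket X Y p + bracket X Y' p :=
  VectorField.mlieBracket_add_right hY hY'

theorem isManifold_minSmoothness_two : IsManifold (𝓡 4) (minSmoothness ℝ 2) M := by
  rw [minSmoothness_of_isRCLikeNormedField]
  infer_instance

theorem SmoothFieldAt.bracket {X Y : VField M} (hX : SmoothFieldAt X p) (hY : SmoothFieldAt Y p) :
    SmoothFieldAt (bracket X Y) p := by
  have : IsManifold (𝓡 4) (minSmoothness ℝ 2) M := isManifold_minSmoothness_two
  have : IsManifold (𝓡 4) (((⊤ : ℕ∞) : WithTop ℕ∞) + 1) M := ‹IsManifold (𝓡 4) ∞ M›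
  exact ContMDiffAt.mlieBracket_vectorField (n := ⊤) (m := ⊤) hX hY
    (by rw [minSmoothness_of_isRCLikeNormedField]; simp)

theorem SmoothFieldAt.dir {X : VField M} {f : M → ℝ} (hX : SmoothFieldAt X p)
    (hf : ContMDiffAt (𝓡 4) 𝓘(ℝ, ℝ) ∞ f p) : ContMDiffAt (𝓡 4) 𝓘(ℝ, ℝ) ∞ (dir X f) p := by
  have h := ContMDiffAt.clm_apply_of_inCoordinates (n := ∞)
    (E₁ := fun q : M ↦ TangentSpace (𝓡 4) q) (E₂ := fun x : ℝ ↦ TangentSpace 𝓘(ℝ, ℝ) x)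
    (b₁ := id) (b₂ := f) (v := X) (ϕ := fun q ↦ mfderiv (𝓡 4) 𝓘(ℝ, ℝ) f q)
    (hf.mfderiv_const (m := ∞) (by simp)) hX hf
  exact (contMDiff_snd_tangentBundle_modelSpace ℝ 𝓘(ℝ, ℝ)).contMDiffAt.comp p h

theorem pair_apply (X Y : VField M) (q : M) : g.pair X Y q = g.inner q (X q) (Y q) := rfl

variable {X Y Z : VField M} {f : M → ℝ}

/-- The derivatives of `f` from the metric terms cancel against those from the brackets. -/
theorem nabla_smul_left (hf : DiffAt f p) (hX : DiffFieldAt X p) (hY : DiffFieldAt Y p)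
    (hZ : DiffFieldAt Z p) : g.nabla (f • X) Y Z p = f p * g.nabla X Y Z p := by
  simp only [LorentzMetric.nabla, pair_smul_left, dir_smul_left, dir_mul hf (hX.pair hZ),
    dir_mul hf (hX.pair hY)]
  simp only [pair_apply, bracket_smul_left hf hX, map_add, map_smul, _root_.add_apply,
    _root_.smul_apply, smul_eq_mul, Pi.smul_apply', g.symm p (X p)]
  ring

theorem nabla_smul_right (hf : DiffAt f p) (hX : DiffFieldAt X p) (hY : DiffFieldAt Y p)
    (hZ : DiffFieldAt Z p) : g.nabla X Y (f • Z) p = f p * g.nabla X Y Z p := by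
  simp only [LorentzMetric.nabla, pair_smul_right, dir_smul_left, dir_mul hf (hX.pair hZ),
    dir_mul hf (hY.pair hZ)]
  simp only [pair_apply, bracket_smul_right hf hZ, map_add, map_smul, _root_.add_apply,
    _root_.smul_apply, smul_eq_mul, Pi.mul_apply, g.symm p (Z p)]
  ring

/-- The Leibniz rule for the Levi-Civita connection. -/
theorem nabla_smul_middle (hf : DiffAt f p) (hX : DiffFieldAt X p) (hY : DiffFieldAt Y p)
    (hZ : DiffFieldAt Z p) :
    g.nabla X (f • Y) Z p = f p * g.nabla X Y Z p + dir X f p * g.pair Y Z p := by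
  simp only [LorentzMetric.nabla, pair_smul_right, pair_smul_left, dir_smul_left,
    dir_mul hf (hY.pair hZ), dir_mul hf (hX.pair hY)]
  simp only [pair_apply, bracket_smul_right hf hY, bracket_smul_left hf hY, map_add, map_smul,
    _root_.add_apply,
    _root_.smul_apply, smul_eq_mul, Pi.mul_apply, g.symm p (Y p)]
  ring

theorem nabla_add_left {X' : VField M} (hX : DiffFieldAt X p) (hX' : DiffFieldAt X' p)
    (hY : DiffFieldAt Y p) (hZ : DiffFieldAt Z p) :
    g.nabla (X + X') Y Z p = g.nabla X Y Z p + g.nabla X' Y Z p := by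
  simp only [LorentzMetric.nabla, pair_add_left, dir_add_left, dir_add (hX.pair hZ) (hX'.pair hZ),
    dir_add (hX.pair hY) (hX'.pair hY)]
  simp only [pair_apply, bracket_add_left hX hX', map_add, _root_.add_apply,
    Pi.add_apply]
  ring

theorem nabla_add_right {Z' : VField M} (hX : DiffFieldAt X p) (hY : DiffFieldAt Y p)
    (hZ : DiffFieldAt Z p) (hZ' : DiffFieldAt Z' p) :
    g.nabla X Y (Z + Z') p = g.nabla X Y Z p + g.nabla X Y Z' p := by
  simp only [LorentzMetric.nabla, pair_add_right, dir_add_left, dir_add (hX.pair hZ) (hX.pair hZ'),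
    dir_add (hY.pair hZ) (hY.pair hZ')]
  simp only [pair_apply, bracket_add_right hZ hZ', map_add, _root_.add_apply,
    Pi.add_apply]
  ring

theorem nabla_add_middle {Y' : VField M} (hX : DiffFieldAt X p) (hY : DiffFieldAt Y p)
    (hY' : DiffFieldAt Y' p) (hZ : DiffFieldAt Z p) :
    g.nabla X (Y + Y') Z p = g.nabla X Y Z p + g.nabla X Y' Z p := by
  simp only [LorentzMetric.nabla, pair_add_left, pair_add_right, dir_add_left,
    dir_add (hY.pair hZ) (hY'.pair hZ), dir_add (hX.pair hY) (hX.pair hY')]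
  simp only [pair_apply, bracket_add_right hY hY', bracket_add_left hY hY', map_add,
    _root_.add_apply, Pi.add_apply]
  ring

/-- The Levi-Civita connection is compatible with the metric. -/
theorem nabla_add_nabla_swap (X Y Z : VField M) :
    g.nabla X Y Z p + g.nabla X Z Y p = dir X (g.pair Y Z) p := by
  simp only [LorentzMetric.nabla, pair_comm Z Y, pair_apply, bracket_swap Z Y, map_neg,
    _root_.neg_apply]
  ring

/-- The Levi-Civita connection is torsion-free. -/
theorem dFlat_eq_nabla_sub (L X Y : VField M) :
    g.dFlat L X Y p = g.nabla X L Y p - g.nabla Y L X p := by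
  simp only [LorentzMetric.nabla, LorentzMetric.dFlat, pair_comm Y X, pair_comm X L,
    pair_comm Y L, pair_apply,
    bracket_swap Y X, bracket_swap Y L, bracket_swap X L, map_neg, _root_.neg_apply,
    g.symm p (L p)]
  ring

theorem nabla_congr {X' Y' Z' : VField M} (hX : X =ᶠ[𝓝 p] X') (hY : Y =ᶠ[𝓝 p] Y')
    (hZ : Z =ᶠ[𝓝 p] Z') : g.nabla X Y Z p = g.nabla X' Y' Z' p := by
  have hpair : ∀ {A A' B B' : VField M}, A =ᶠ[𝓝 p] A' → B =ᶠ[𝓝 p] B' →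
      g.pair A B =ᶠ[𝓝 p] g.pair A' B' := by
    intro A A' B B' hA hB
    filter_upwards [hA, hB] with q hA hB
    simp [pair_apply, hA, hB]
  have hbr : ∀ {A A' B B' : VField M}, A =ᶠ[𝓝 p] A' → B =ᶠ[𝓝 p] B' →
      bracket A B p = bracket A' B' p := fun hA hB ↦ hA.mlieBracket_vectorField_eq hB
  simp only [LorentzMetric.nabla, dir_congr hX.self_of_nhds (hpair hY hZ),
    dir_congr hY.self_of_nhds (hpair hX hZ), dir_congr hZ.self_of_nhds (hpair hX hY)]
  simp only [pair_apply, hbr hX hY, hbr hX hZ, hbr hY hZ, hX.self_of_nhds, hY.self_of_nhds,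
    hZ.self_of_nhds]

/-- Supplies smooth right-hand sides for the equations determining the boost parameters, which are
built from connection coefficients. -/
theorem SmoothFieldAt.nabla (hX : SmoothFieldAt X p) (hY : SmoothFieldAt Y p)
    (hZ : SmoothFieldAt Z p) : ContMDiffAt (𝓡 4) 𝓘(ℝ, ℝ) ∞ (g.nabla X Y Z) p := by
  have h := (((((hX.dir (hY.pair (g := g) hZ)).add (hY.dir (hX.pair (g := g) hZ))).sub
    (hZ.dir (hX.pair (g := g) hY))).add
    ((hX.bracket hY).pair (g := g) hZ)).sub ((hX.bracket hZ).pair (g := g) hY)).sub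
    ((hY.bracket hZ).pair (g := g) hX)
  exact h.div_const 2

theorem tensorialAt_nabla_left (hY : DiffFieldAt Y p) (hZ : DiffFieldAt Z p) :
    TensorialAt (𝓡 4) (EuclideanSpace ℝ (Fin 4)) (fun X : VField M ↦ g.nabla X Y Z p) p where
  smul hf hX := nabla_smul_left hf hX hY hZ
  add hX hX' := nabla_add_left hX hX' hY hZ

theorem tensorialAt_nabla_right (hX : DiffFieldAt X p) (hY : DiffFieldAt Y p) :
    TensorialAt (𝓡 4) (EuclideanSpace ℝ (Fin 4)) (fun Z : VField M ↦ g.nabla X Y Z p) p where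
  smul hf hZ := nabla_smul_right hf hX hY hZ
  add hZ hZ' := nabla_add_right hX hY hZ hZ'

/-- The bilinear form `(v, w) ↦ g(∇_v Y, w)` on the tangent space. -/
theorem exists_nablaForm (g : LorentzMetric M) (hY : DiffFieldAt Y p) :
    ∃ B : TangentSpace (𝓡 4) p →L[ℝ] TangentSpace (𝓡 4) p →L[ℝ] ℝ,
      ∀ X Z : VField M, DiffFieldAt X p → DiffFieldAt Z p → g.nabla X Y Z p = B (X p) (Z p) := by
  refine ⟨TensorialAt.mkHom₂ (I := 𝓡 4) (F := EuclideanSpace ℝ (Fin 4))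
    (F' := EuclideanSpace ℝ (Fin 4)) (fun X Z : VField M ↦ g.nabla X Y Z p) p
    (fun Z hZ ↦ tensorialAt_nabla_left hY hZ) (fun X hX ↦ tensorialAt_nabla_right hX hY), ?_⟩
  intro X Z hX hZ
  exact (TensorialAt.mkHom₂_apply (I := 𝓡 4) (F := EuclideanSpace ℝ (Fin 4))
    (F' := EuclideanSpace ℝ (Fin 4)) (Φ := fun X Z : VField M ↦ g.nabla X Y Z p)
    (fun Z hZ ↦ tensorialAt_nabla_left hY hZ) (fun X hX ↦ tensorialAt_nabla_right hX hY)
    hX hZ).symm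

end Connection

/-! ### Null frames and the real components of the spin coefficients -/

section Frames

variable {M : Type*} [TopologicalSpace M] [ChartedSpace (EuclideanSpace ℝ (Fin 4)) M]
  [IsManifold (𝓡 4) ∞ M] {g : LorentzMetric M} {U : Set M} {q : M}

theorem SmoothFieldOn.at {X : VField M} (h : SmoothFieldOn X U) (hU : IsOpen U) (hq : q ∈ U) :
    SmoothFieldAt X q :=
  ContMDiffOn.contMDiffAt h (hU.mem_nhds hq)

theorem smoothFieldOn_of_at {X : VField M} (h : ∀ q ∈ U, SmoothFieldAt X q) : SmoothFieldOn X U :=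
  fun q hq ↦ (h q hq).contMDiffWithinAt

theorem SmoothFieldAt.add {X Y : VField M} (hX : SmoothFieldAt X q) (hY : SmoothFieldAt Y q) :
    SmoothFieldAt (X + Y) q :=
  ContMDiffAt.add_section hX hY

theorem SmoothFieldAt.smul {X : VField M} {f : M → ℝ} (hf : ContMDiffAt (𝓡 4) 𝓘(ℝ, ℝ) ∞ f q)
    (hX : SmoothFieldAt X q) : SmoothFieldAt (f • X) q :=
  ContMDiffAt.smul_section hf hX

theorem SmoothFieldAt.const_smul {X : VField M} (c : ℝ) (hX : SmoothFieldAt X q) :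
    SmoothFieldAt (c • X) q :=
  ContMDiffAt.const_smul_section hX

theorem pair_const_smul_left (c : ℝ) (X Y : VField M) : g.pair (c • X) Y q = c * g.pair X Y q := by
  simp [LorentzMetric.pair]

theorem pair_const_smul_right (c : ℝ) (X Y : VField M) :
    g.pair X (c • Y) q = c * g.pair X Y q := by
  simp [LorentzMetric.pair]

/-- Metric compatibility gives `2 g(∇_X L, L) = X(g(L, L))`, which is zero for a null field. -/
theorem nabla_self (L X : VField M) (h : ∀ᶠ x in 𝓝 q, g.pair L L x = 0) : g.nabla X L L q = 0 := by
  have h1 := nabla_add_nabla_swap (g := g) (p := q) X L L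
  have h2 : dir X (g.pair L L) q = 0 := by
    rw [dir_congr (f' := fun _ ↦ (0 : ℝ)) rfl h]
    simp [dir, mvfderiv_const]
  linarith

/-- Expansion of a tangent vector in a null basis `l, n, a ± i b`. -/
theorem nullBasis_expansion {l n a b : TangentSpace (𝓡 4) q} (hll : g.inner q l l = 0)
    (hnn : g.inner q n n = 0) (hln : g.inner q l n = 1) (hla : g.inner q l a = 0)
    (hlb : g.inner q l b = 0) (hna : g.inner q n a = 0) (hnb : g.inner q n b = 0)
    (haa : g.inner q a a = -1 / 2) (hbb : g.inner q b b = -1 / 2) (hab : g.inner q a b = 0)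
    (v : TangentSpace (𝓡 4) q) :
    v = g.inner q n v • l + g.inner q l v • n + (-2 * g.inner q a v) • a
      + (-2 * g.inner q b v) • b := by
  have hnl := (g.symm q n l).trans hln
  have hal := (g.symm q a l).trans hla
  have hbl := (g.symm q b l).trans hlb
  have han := (g.symm q a n).trans hna
  have hbn := (g.symm q b n).trans hnb
  have hba := (g.symm q b a).trans hab
  have hli : LinearIndependent ℝ ![l, n, a, b] := by
    rw [Fintype.linearIndependent_iff]
    intro c hc
    simp only [Fin.sum_univ_four, Matrix.cons_val_zero, Matrix.cons_val_one, Matrix.cons_val] at hc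
    -- Pairing the relation with `n, l, a, b` isolates the coefficients of `l, n, a, b`
    -- respectively.
    have h0 := congrArg (g.inner q n) hc
    have h1 := congrArg (g.inner q l) hc
    have h2 := congrArg (g.inner q a) hc
    have h3 := congrArg (g.inner q b) hc
    simp only [map_add, map_smul, smul_eq_mul, map_zero, hll, hnn, hln, hla, hlb, hna, hnb, haa,
      hbb, hab, hnl, hal, hbl, han, hbn, hba] at h0 h1 h2 h3
    intro i
    fin_cases i <;> simp <;> linarith
  have hfin : Module.finrank ℝ (TangentSpace (𝓡 4) q) = 4 :=
    finrank_euclideanSpace_fin (𝕜 := ℝ) (n := 4)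
  have : FiniteDimensional ℝ (TangentSpace (𝓡 4) q) :=
    inferInstanceAs (FiniteDimensional ℝ (EuclideanSpace ℝ (Fin 4)))
  have hspan := hli.span_eq_top_of_card_eq_finrank' (by simp [hfin])
  have hv : v ∈ Submodule.span ℝ (range ![l, n, a, b]) := by rw [hspan]; trivial
  obtain ⟨c, rfl⟩ := (Submodule.mem_span_range_iff_exists_fun ℝ).1 hv
  simp only [Fin.sum_univ_four, Matrix.cons_val_zero, Matrix.cons_val_one, Matrix.cons_val, map_add,
    map_smul, smul_eq_mul, hll, hnn, hln, hla, hlb, hna, hnb, haa,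
      hbb, hab, hnl, hal, hbl, han, hbn, hba]
  ring_nf

namespace NullFrame

variable (e : NullFrame g U)

theorem smooth_l_at (hU : IsOpen U) (hq : q ∈ U) : SmoothFieldAt e.l q := e.smooth_l.at hU hq
theorem smooth_n_at (hU : IsOpen U) (hq : q ∈ U) : SmoothFieldAt e.n q := e.smooth_n.at hU hq
theorem smooth_re_at (hU : IsOpen U) (hq : q ∈ U) : SmoothFieldAt e.m.re q := e.smooth_re.at hU hq
theorem smooth_im_at (hU : IsOpen U) (hq : q ∈ U) : SmoothFieldAt e.m.im q := e.smooth_im.at hU hq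

theorem l_re (hq : q ∈ U) : g.pair e.l e.m.re q = 0 := by
  simpa [LorentzMetric.cpair, CField.ofReal, pair_apply] using congrArg Complex.re (e.l_m q hq)

theorem l_im (hq : q ∈ U) : g.pair e.l e.m.im q = 0 := by
  simpa [LorentzMetric.cpair, CField.ofReal, pair_apply] using congrArg Complex.im (e.l_m q hq)

theorem n_re (hq : q ∈ U) : g.pair e.n e.m.re q = 0 := by
  simpa [LorentzMetric.cpair, CField.ofReal, pair_apply] using congrArg Complex.re (e.n_m q hq)

theorem n_im (hq : q ∈ U) : g.pair e.n e.m.im q = 0 := by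
  simpa [LorentzMetric.cpair, CField.ofReal, pair_apply] using congrArg Complex.im (e.n_m q hq)

theorem re_im (hq : q ∈ U) : g.pair e.m.re e.m.im q = 0 := by
  have h := congrArg Complex.im (e.m_m q hq)
  simp only [LorentzMetric.cpair, pair_comm e.m.im, Complex.zero_im] at h
  linarith

/-- `g(m, m) = 0` makes the real and imaginary parts of `m` equally long, and `g(m, m̄) = -1` fixes
the sum of their squares. -/
theorem re_re (hq : q ∈ U) : g.pair e.m.re e.m.re q = -1 / 2 := by
  have h := congrArg Complex.re (e.m_m q hq)
  have h' := congrArg Complex.re (e.m_conj q hq)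
  simp only [LorentzMetric.cpair, Complex.zero_re, CField.conj, pair_apply, map_neg,
    Complex.neg_re, Complex.one_re] at h h' ⊢
  linarith

theorem im_im (hq : q ∈ U) : g.pair e.m.im e.m.im q = -1 / 2 := by
  have h := congrArg Complex.re (e.m_m q hq)
  have h' := congrArg Complex.re (e.m_conj q hq)
  simp only [LorentzMetric.cpair, Complex.zero_re, CField.conj, pair_apply, map_neg,
    Complex.neg_re, Complex.one_re] at h h' ⊢
  linarith

theorem expansion (hq : q ∈ U) (v : TangentSpace (𝓡 4) q) :
    v = g.inner q (e.n q) v • e.l q + g.inner q (e.l q) v • e.n q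
      + (-2 * g.inner q (e.m.re q) v) • e.m.re q + (-2 * g.inner q (e.m.im q) v) • e.m.im q :=
  nullBasis_expansion (e.l_l q hq) (e.n_n q hq) (e.l_n q hq) (e.l_re hq) (e.l_im hq) (e.n_re hq)
    (e.n_im hq) (e.re_re hq) (e.im_im hq) (e.re_im hq) v

end NullFrame

theorem nabla_zero_left (Y Z : VField M) (hY : DiffFieldAt Y q) (hZ : DiffFieldAt Z q) :
    g.nabla (fun _ ↦ 0) Y Z q = 0 :=
  (tensorialAt_nabla_left hY hZ).zero

theorem smoothFieldAt_zero : SmoothFieldAt (fun _ ↦ 0 : VField M) q :=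
  Bundle.contMDiff_zeroSection ℝ (TangentSpace (𝓡 4) : M → Type _) q

theorem nabla_zero_right (X Y : VField M) (hX : DiffFieldAt X q) (hY : DiffFieldAt Y q) :
    g.nabla X Y (fun _ ↦ 0) q = 0 :=
  (tensorialAt_nabla_right hX hY).zero

/-- The middle slot is not tensorial, so the value is deduced from additivity and `0 + 0 = 0`. -/
theorem nabla_zero_middle (X Z : VField M) (hX : DiffFieldAt X q) (hZ : DiffFieldAt Z q) :
    g.nabla X (fun _ ↦ 0) Z q = 0 := by
  have h0 : DiffFieldAt (fun _ ↦ 0 : VField M) q := smoothFieldAt_zero.diff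
  have h := nabla_add_middle (g := g) hX h0 h0 hZ
  have h' : (fun _ ↦ 0 : VField M) + (fun _ ↦ 0) = fun _ ↦ 0 := by ext; simp
  rw [h'] at h
  linarith

theorem nabla_const_smul_left (c : ℝ) {X Y Z : VField M} (hX : DiffFieldAt X q)
    (hY : DiffFieldAt Y q) (hZ : DiffFieldAt Z q) :
    g.nabla (c • X) Y Z q = c * g.nabla X Y Z q :=
  nabla_smul_left (f := fun _ ↦ c) mdifferentiableAt_const hX hY hZ

theorem nabla_const_smul_right (c : ℝ) {X Y Z : VField M} (hX : DiffFieldAt X q)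
    (hY : DiffFieldAt Y q) (hZ : DiffFieldAt Z q) :
    g.nabla X Y (c • Z) q = c * g.nabla X Y Z q :=
  nabla_smul_right (f := fun _ ↦ c) mdifferentiableAt_const hX hY hZ

theorem nabla_neg_left {X Y Z : VField M} (hX : DiffFieldAt X q)
    (hY : DiffFieldAt Y q) (hZ : DiffFieldAt Z q) :
    g.nabla (fun x ↦ - X x) Y Z q = - g.nabla X Y Z q := by
  have h := nabla_const_smul_left (g := g) (-1) hX hY hZ
  have h' : (-1 : ℝ) • X = fun x ↦ - X x := by ext; simp
  rw [h'] at h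
  linarith

theorem nabla_neg_right {X Y Z : VField M} (hX : DiffFieldAt X q)
    (hY : DiffFieldAt Y q) (hZ : DiffFieldAt Z q) :
    g.nabla X Y (fun x ↦ - Z x) q = - g.nabla X Y Z q := by
  have h := nabla_const_smul_right (g := g) (-1) hX hY hZ
  have h' : (-1 : ℝ) • Z = fun x ↦ - Z x := by ext; simp
  rw [h'] at h
  linarith

section SpinCoefficients

variable {e : Tetrad M} (hl : SmoothFieldAt e.l q) (hn : SmoothFieldAt e.n q)
  (hre : SmoothFieldAt e.m.re q) (him : SmoothFieldAt e.m.im q)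
include hl hre him

theorem kappa_eq : kappa g e q = ⟨g.nabla e.l e.l e.m.re q, g.nabla e.l e.l e.m.im q⟩ := by
  have h0 : DiffFieldAt (fun _ ↦ 0 : VField M) q := smoothFieldAt_zero.diff
  simp [kappa, LorentzMetric.cnabla, CField.ofReal, nabla_zero_left, nabla_zero_middle, h0,
    hl.diff, hre.diff, him.diff]

theorem sigma_eq : sigma g e q =
    ⟨g.nabla e.m.re e.l e.m.re q - g.nabla e.m.im e.l e.m.im q,
      g.nabla e.m.im e.l e.m.re q + g.nabla e.m.re e.l e.m.im q⟩ := by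
  simp [sigma, LorentzMetric.cnabla, CField.ofReal, nabla_zero_middle,
    hre.diff, him.diff]

/-- The real part is the trace (expansion) and the imaginary part the antisymmetric part (twist) of
`B` on the span of `m.re, m.im`. With the trace-free symmetric part `σ` they determine all four
entries. -/
theorem rho_eq : rho g e q =
    ⟨g.nabla e.m.re e.l e.m.re q + g.nabla e.m.im e.l e.m.im q,
      g.nabla e.m.re e.l e.m.im q - g.nabla e.m.im e.l e.m.re q⟩ := by
  have hneg : DiffFieldAt (fun x ↦ - e.m.im x) q :=
    (ContMDiffAt.neg_section him).mdifferentiableAt (by simp)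
  simp only [rho, LorentzMetric.cnabla, CField.ofReal, CField.conj, nabla_zero_middle, hneg,
    hl.diff, hre.diff, him.diff, nabla_neg_left]
  congr 1 <;> ring

include hn in
theorem epsilon_eq : epsilon g e q =
    (⟨g.nabla e.l e.l e.n q - g.nabla e.l e.m.re e.m.re q - g.nabla e.l e.m.im e.m.im q,
      g.nabla e.l e.m.re e.m.im q - g.nabla e.l e.m.im e.m.re q⟩ : ℂ) / 2 := by
  have h0 : DiffFieldAt (fun _ ↦ 0 : VField M) q := smoothFieldAt_zero.diff
  rw [epsilon]
  congr 1
  apply Complex.ext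
  · simp only [LorentzMetric.cnabla, CField.ofReal, CField.conj, nabla_zero_middle,
      nabla_zero_left, nabla_zero_right, h0,
      hl.diff, hre.diff, him.diff, hn.diff, nabla_neg_right, Complex.sub_re]
    ring
  · simp only [LorentzMetric.cnabla, CField.ofReal, CField.conj, nabla_zero_middle,
      nabla_zero_left, nabla_zero_right, h0,
      hl.diff, hre.diff, him.diff, hn.diff, nabla_neg_right, Complex.sub_im]
    ring

end SpinCoefficients

end Frames

/-! ### The Kundt conditions as vanishing of `B` on the orthogonal space of `ℓ` -/

section KundtConditions

variable {M : Type*} [TopologicalSpace M] [ChartedSpace (EuclideanSpace ℝ (Fin 4)) M]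
  [IsManifold (𝓡 4) ∞ M] {g : LorentzMetric M} {U : Set M} {q : M}

/-- The bilinear form `B(X, Y) = g(∇_X L, Y)` vanishes on the orthogonal space of `L` at `q`. -/
def VanishesOnOrthogonalAt (g : LorentzMetric M) (L : VField M) (q : M) : Prop :=
  ∀ X Y : VField M, SmoothFieldAt X q → SmoothFieldAt Y q → g.pair L X q = 0 → g.pair L Y q = 0 →
    g.nabla X L Y q = 0

/-- In `∇_X(A L) = A ∇_X L + X(A) L` the last term is killed by pairing with a vector orthogonal to
`L`. The condition therefore depends only on the direction of `L`. -/
theorem vanishesOnOrthogonalAt_iff_of_smul {L L' : VField M} {A : M → ℝ} (hL : SmoothFieldAt L q)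
    (hA : ContMDiffAt (𝓡 4) 𝓘(ℝ, ℝ) ∞ A q) (hA0 : A q ≠ 0) (h : ∀ᶠ x in 𝓝 q, L' x = A x • L x) :
    VanishesOnOrthogonalAt g L' q ↔ VanishesOnOrthogonalAt g L q := by
  have hpair : ∀ X, g.pair L' X q = 0 ↔ g.pair L X q = 0 := by
    intro X
    simp [pair_apply, h.self_of_nhds, hA0]
  refine forall₄_congr fun X Y hX hY ↦ ?_
  simp only [hpair]
  refine forall₂_congr fun _ hLY ↦ ?_
  have h1 : g.nabla X L' Y q = g.nabla X (A • L) Y q :=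
    nabla_congr (.refl _ _) h (.refl _ _)
  rw [h1, nabla_smul_middle (hA.mdifferentiableAt (by simp)) hX.diff hL.diff hY.diff, hLY]
  simp [hA0]

/-- Of the nine entries of `B` on `ℓ, m.re, m.im`, three have `ℓ` in the second slot and vanish by
nullity, two form `κ`, and four are combinations of `ρ` and `σ`. The right-hand side no longer
mentions `n` or `m`, which gives the invariance under frame changes. -/
theorem kundtConditionsOn_iff (hU : IsOpen U) (e : NullFrame g U) :
    KundtConditionsOn g U e.toTetrad ↔ ∀ q ∈ U, VanishesOnOrthogonalAt g e.l q := by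
  refine forall₂_congr fun q hq ↦ ?_
  have hl := e.smooth_l_at hU hq
  have hre := e.smooth_re_at hU hq
  have him := e.smooth_im_at hU hq
  rw [kappa_eq hl hre him, rho_eq hl hre him, sigma_eq hl hre him]
  constructor
  · rintro ⟨hκ, hρ, hσ⟩ X Y hX hY hLX hLY
    simp only [Complex.ext_iff, Complex.zero_re, Complex.zero_im] at hκ hρ hσ
    have hll : ∀ Z : VField M, g.nabla Z e.l e.l q = 0 := fun Z ↦
      nabla_self _ _ (Filter.eventually_of_mem (hU.mem_nhds hq) e.l_l)
    obtain ⟨B, hB⟩ := exists_nablaForm g hl.diff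
    have h1 := hll e.l
    have h2 := hll e.m.re
    have h3 := hll e.m.im
    have h4 := hκ.1
    have h5 := hκ.2
    have h6 : g.nabla e.m.re e.l e.m.re q = 0 := by linarith [hρ.1, hσ.1]
    have h7 : g.nabla e.m.im e.l e.m.im q = 0 := by linarith [hρ.1, hσ.1]
    have h8 : g.nabla e.m.re e.l e.m.im q = 0 := by linarith [hρ.2, hσ.2]
    have h9 : g.nabla e.m.im e.l e.m.re q = 0 := by linarith [hρ.2, hσ.2]
    rw [hB _ _ (by exact SmoothFieldAt.diff ‹_›) (by exact SmoothFieldAt.diff ‹_›)]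
      at h1 h2 h3 h4 h5 h6 h7 h8 h9 ⊢
    rw [e.expansion hq (X q), e.expansion hq (Y q)]
    rw [pair_apply] at hLX hLY
    simp [hLX, hLY, h1, h2, h3, h4, h5, h6, h7, h8, h9]
  · intro h
    have hll := e.l_l q hq
    have hlr := e.l_re hq
    have hli := e.l_im hq
    simp only [h _ _ hl hre hll hlr, h _ _ hl him hll hli, h _ _ hre hre hlr hlr,
      h _ _ hre him hlr hli, h _ _ him hre hli hlr, h _ _ him him hli hli]
    refine ⟨?_, ?_, ?_⟩ <;> apply Complex.ext <;> simp

theorem kundtConditionsOn_iff_of_smul (hU : IsOpen U) {e e' : NullFrame g U} {A : M → ℝ}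
    (hA : ContMDiffOn (𝓡 4) 𝓘(ℝ, ℝ) ∞ A U) (h : ∀ q ∈ U, A q ≠ 0 ∧ e'.l q = A q • e.l q) :
    KundtConditionsOn g U e'.toTetrad ↔ KundtConditionsOn g U e.toTetrad := by
  rw [kundtConditionsOn_iff hU, kundtConditionsOn_iff hU]
  exact forall₂_congr fun q hq ↦ vanishesOnOrthogonalAt_iff_of_smul (e.smooth_l_at hU hq)
    (hA.contMDiffAt (hU.mem_nhds hq)) (h q hq).1
    (Filter.eventually_of_mem (hU.mem_nhds hq) fun x hx ↦ (h x hx).2)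

theorem IsSpinBoostOn.kundtConditionsOn_iff (hU : IsOpen U) {e e' : NullFrame g U}
    (h : IsSpinBoostOn U e.toTetrad e'.toTetrad) :
    KundtConditionsOn g U e'.toTetrad ↔ KundtConditionsOn g U e.toTetrad := by
  obtain ⟨A, w, hA, -, h⟩ := h
  exact kundtConditionsOn_iff_of_smul hU hA fun q hq ↦ ⟨(h q hq).1.ne', (h q hq).2.2.1⟩

theorem IsNullRotationOn.kundtConditionsOn_iff (hU : IsOpen U) {e e' : NullFrame g U}
    (h : IsNullRotationOn U e.toTetrad e'.toTetrad) :
    KundtConditionsOn g U e'.toTetrad ↔ KundtConditionsOn g U e.toTetrad := by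
  obtain ⟨z, -, h⟩ := h
  exact kundtConditionsOn_iff_of_smul (A := fun _ ↦ 1) hU contMDiffOn_const
    fun q hq ↦ ⟨one_ne_zero, by rw [(h q hq).1, one_smul]⟩

theorem SameFamily.kundtConditionsOn_iff (hU : IsOpen U) {e e' : NullFrame g U}
    (h : SameFamily e e') :
    KundtConditionsOn g U e'.toTetrad ↔ KundtConditionsOn g U e.toTetrad := by
  induction h with
  | rel a b h =>
    exact h.elim (IsNullRotationOn.kundtConditionsOn_iff hU)
      (IsSpinBoostOn.kundtConditionsOn_iff hU)
  | refl a => rfl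
  | symm a b _ ih => exact ih.symm
  | trans a b c _ _ ih ih' => exact ih'.trans ih

/-- A form vanishing on the kernel of `ω` has every term divisible by `ω` in one slot; its
antisymmetrization `dω` is then `ω ∧ η` for some `η`, so `ω ∧ dω = 0`. -/
theorem isHypersurfaceOrthogonalOn_of_kundtConditionsOn (hU : IsOpen U) (e : NullFrame g U)
    (he : KundtConditionsOn g U e.toTetrad) : IsHypersurfaceOrthogonalOn g U e.l := by
  rw [kundtConditionsOn_iff hU] at he
  intro q hq X Y Z hX hY hZ
  have hl := e.smooth_l_at hU hq
  have hn := e.smooth_n_at hU hq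
  have hln := e.l_n q hq
  obtain ⟨B, hB⟩ := exists_nablaForm g hl.diff
  -- Subtracting `g(ℓ, V) n` projects `V` onto the orthogonal space of `ℓ`, where `B` vanishes;
  -- expanding gives the formula.
  have key : ∀ {V W : VField M}, SmoothFieldAt V q → SmoothFieldAt W q →
      B (V q) (W q) = g.pair e.l W q * B (V q) (e.n q) + g.pair e.l V q * B (e.n q) (W q)
        - g.pair e.l V q * g.pair e.l W q * B (e.n q) (e.n q) := by
    intro V W hV hW
    have hproj : ∀ {V : VField M}, g.pair e.l (V + (- g.pair e.l V q) • e.n) q = 0 := by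
      intro V
      rw [pair_add_right, Pi.add_apply, pair_const_smul_right, hln]
      ring
    have hV' := hV.add (hn.const_smul (- g.pair e.l V q))
    have hW' := hW.add (hn.const_smul (- g.pair e.l W q))
    have h := he q hq _ _ hV' hW' hproj hproj
    rw [hB _ _ hV'.diff hW'.diff] at h
    simp only [Pi.add_apply, Pi.smul_apply, map_add, map_smul, _root_.add_apply,
      _root_.smul_apply, smul_eq_mul] at h
    linear_combination h
  simp only [dFlat_eq_nabla_sub, hB _ _ hX.diff hY.diff, hB _ _ hY.diff hX.diff,
    hB _ _ hX.diff hZ.diff, hB _ _ hZ.diff hX.diff, hB _ _ hY.diff hZ.diff, hB _ _ hZ.diff hY.diff]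
  rw [key hX hY, key hY hX, key hX hZ, key hZ hX, key hY hZ, key hZ hY]
  ring

theorem isNullFieldOn_of_nullFrame (e : NullFrame g U) : IsNullFieldOn g U e.l := by
  refine ⟨e.smooth_l, fun q hq ↦ ⟨fun h ↦ ?_, e.l_l q hq⟩⟩
  have := e.l_n q hq
  simp [pair_apply, h] at this

theorem isKundtNear_of_hasKundtFramesNear {p : M} (h : HasKundtFramesNear g p) :
    IsKundtNear g p := by
  obtain ⟨U, hU, hp, F, ⟨e, he⟩, -, hF⟩ := h
  have hK := hF e he
  have hV := (kundtConditionsOn_iff hU e).1 hK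
  refine ⟨U, hU, hp, e.l, isNullFieldOn_of_nullFrame e,
    isHypersurfaceOrthogonalOn_of_kundtConditionsOn hU e hK, ?_, ?_⟩
  · rintro q hq X Y ⟨hX, hY, hLX, hLY, -⟩
    simp [hV q hq X X hX hX hLX hLX, hV q hq Y Y hY hY hLY hLY]
  · rintro q hq X Y ⟨hX, hY, hLX, hLY, -⟩
    simp [hV q hq X X hX hX hLX hLX, hV q hq Y Y hY hY hLY hLY, hV q hq X Y hX hY hLX hLY,
      hV q hq Y X hY hX hLY hLX]

theorem kundtConditionsOn_of_isHypersurfaceOrthogonalOn (hU : IsOpen U) (e : NullFrame g U)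
    (h1 : IsHypersurfaceOrthogonalOn g U e.l) (h2 : IsNonDivergingOn g U e.l)
    (h3 : IsNonShearingOn g U e.l) : KundtConditionsOn g U e.toTetrad := by
  intro q hq
  have hl := e.smooth_l_at hU hq
  have hn := e.smooth_n_at hU hq
  have hre := e.smooth_re_at hU hq
  have him := e.smooth_im_at hU hq
  have hlr := e.l_re hq
  have hli := e.l_im hq
  have hll : ∀ Z : VField M, g.nabla Z e.l e.l q = 0 := fun Z ↦
    nabla_self _ _ (Filter.eventually_of_mem (hU.mem_nhds hq) e.l_l)
  -- Since `ω` is `1` on `n` and `0` on `ℓ, m.re, m.im`, these triples isolate `dω` on pairs of the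
  -- latter. The first two yield `κ = 0` because `B(·, ℓ) = 0`; the third yields symmetry of `B` on
  -- the screen.
  have hd1 := h1 q hq _ _ _ hn hl hre
  have hd2 := h1 q hq _ _ _ hn hl him
  have hd3 := h1 q hq _ _ _ hn hre him
  simp only [e.l_n q hq, e.l_l q hq, hlr, hli, dFlat_eq_nabla_sub, hll] at hd1 hd2 hd3
  -- The factor `√2` normalizes `m.re, m.im`, whose squares are `-1 / 2`.
  have hscreen : IsScreenPairAt g e.l (√2 • e.m.re) (√2 • e.m.im) q := by
    refine ⟨hre.const_smul _, him.const_smul _, ?_, ?_, ?_, ?_, ?_⟩ <;>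
      simp only [pair_const_smul_left, pair_const_smul_right, hlr, hli, e.re_re hq, e.im_im hq,
        e.re_im hq, mul_zero, ← mul_assoc, Real.mul_self_sqrt zero_le_two] <;> norm_num
  have hs1 := h2 q hq _ _ hscreen
  have hs2 := h3 q hq _ _ hscreen
  rw [kappa_eq hl hre him, rho_eq hl hre him, sigma_eq hl hre him]
  have hB' : ∀ {X Y : VField M}, SmoothFieldAt X q → SmoothFieldAt Y q →
      g.nabla (√2 • X) e.l (√2 • Y) q = 2 * g.nabla X e.l Y q := by
    intro X Y hX hY
    rw [nabla_const_smul_left _ hX.diff hl.diff (hY.const_smul _).diff,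
      nabla_const_smul_right _ hX.diff hl.diff hY.diff, ← mul_assoc,
      Real.mul_self_sqrt zero_le_two]
  rw [hB' hre hre, hB' him him] at hs1
  rw [hB' hre hre, hB' him him, hB' hre him, hB' him hre] at hs2
  refine ⟨?_, ?_, ?_⟩ <;> apply Complex.ext <;> simp only [Complex.zero_re, Complex.zero_im] <;>
    linarith [hs2.1, hs2.2]

end KundtConditions

/-! ### Completing a null field to a null frame -/

section LocalFrames

variable {M : Type*} [TopologicalSpace M] [ChartedSpace (EuclideanSpace ℝ (Fin 4)) M]
  [IsManifold (𝓡 4) ∞ M] {g : LorentzMetric M} {U : Set M} {p q : M}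

/-- Every tangent vector extends to a vector field which is smooth near the base point. -/
theorem exists_smoothFieldAt_extension (v : TangentSpace (𝓡 4) p) :
    ∃ X : VField M, X p = v ∧ ∀ᶠ q in 𝓝 p, SmoothFieldAt X q := by
  set t := trivializationAt (EuclideanSpace ℝ (Fin 4)) (TangentSpace (𝓡 4) : M → Type _) p
  refine ⟨FiberBundle.extend (EuclideanSpace ℝ (Fin 4)) v, by simp, ?_⟩
  have hp : p ∈ t.baseSet := FiberBundle.mem_baseSet_trivializationAt' p
  filter_upwards [t.open_baseSet.mem_nhds hp] with q hq
  have h : SmoothFieldOn (FiberBundle.extend (EuclideanSpace ℝ (Fin 4)) v) t.baseSet := by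
    rw [SmoothFieldOn, t.contMDiffOn_section_baseSet_iff]
    refine (contMDiffOn_const (c := (t ⟨p, v⟩).2)).congr fun y hy ↦ ?_
    simp [FiberBundle.extend, t, t.apply_mk_symm hy]
  exact h.at t.open_baseSet hq

/-- Through every nonzero null vector there is a null basis, up to normalization. -/
theorem exists_null_basis {l : TangentSpace (𝓡 4) p} (hl : l ≠ 0) (hll : g.inner p l l = 0) :
    ∃ k x y : TangentSpace (𝓡 4) p, g.inner p l k ≠ 0 ∧ g.inner p l x = 0 ∧ g.inner p l y = 0 ∧
      g.inner p k x = 0 ∧ g.inner p k y = 0 ∧ g.inner p x x = -1 ∧ g.inner p y y = -1 ∧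
      g.inner p x y = 0 := by
  obtain ⟨e, he⟩ := g.signature p
  have hG : ∀ c d : Fin 4 → ℝ, g.inner p (∑ i, c i • e i) (∑ i, d i • e i)
      = c 0 * d 0 - c 1 * d 1 - c 2 * d 2 - c 3 * d 3 := by
    intro c d
    simp only [Fin.sum_univ_four, map_add, map_smul, _root_.add_apply, _root_.smul_apply, he,
      smul_eq_mul]
    simp [Matrix.diagonal]
    ring
  have hli : LinearIndependent ℝ e := by
    rw [Fintype.linearIndependent_iff]
    intro c hc i
    have h := hG c (Pi.single i 1)
    rw [hc] at h
    fin_cases i <;> simpa using h.symm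
  have hfin : Module.finrank ℝ (TangentSpace (𝓡 4) p) = 4 :=
    finrank_euclideanSpace_fin (𝕜 := ℝ) (n := 4)
  have : FiniteDimensional ℝ (TangentSpace (𝓡 4) p) :=
    inferInstanceAs (FiniteDimensional ℝ (EuclideanSpace ℝ (Fin 4)))
  have hspan := hli.span_eq_top_of_card_eq_finrank' (by simp [hfin])
  have hlm : l ∈ Submodule.span ℝ (range e) := by rw [hspan]; trivial
  obtain ⟨c, rfl⟩ := (Submodule.mem_span_range_iff_exists_fun ℝ).1 hlm
  rw [hG] at hll
  have hc0 : c 0 ≠ 0 := by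
    intro h0
    have h1 : c 1 = 0 := by nlinarith [sq_nonneg (c 1), sq_nonneg (c 2), sq_nonneg (c 3)]
    have h2 : c 2 = 0 := by nlinarith [sq_nonneg (c 1), sq_nonneg (c 2), sq_nonneg (c 3)]
    have h3 : c 3 = 0 := by nlinarith [sq_nonneg (c 1), sq_nonneg (c 2), sq_nonneg (c 3)]
    exact hl (by simp [Fin.sum_univ_four, h0, h1, h2, h3])
  -- The spatial direction of `l`, of unit length because `l` is null. The last two vectors of an
  -- orthonormal basis starting with `u` give `x, y`, and `k` is the timelike `e 0`, to be made null
  -- later.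
  set u : EuclideanSpace ℝ (Fin 3) := !₂[c 1 / c 0, c 2 / c 0, c 3 / c 0] with hu
  have hin : ∀ v w : EuclideanSpace ℝ (Fin 3),
      inner ℝ v w = v 0 * w 0 + v 1 * w 1 + v 2 * w 2 := by
    intro v w
    simp [PiLp.inner_apply, Fin.sum_univ_three, mul_comm]
  have huu : ‖u‖ = 1 := by
    have h : inner ℝ u u = (1 : ℝ) := by
      rw [hin]
      simp only [hu]
      simp
      field_simp
      linarith
    rw [real_inner_self_eq_norm_sq] at h
    nlinarith [norm_nonneg u]
  have hon : Orthonormal ℝ (({0} : Set (Fin 3)).domRestrict fun _ ↦ u) := by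
    refine ⟨fun i ↦ huu, fun i j hij ↦ (hij (Subsingleton.elim i j)).elim⟩
  obtain ⟨b, hb⟩ := hon.exists_orthonormalBasis_extension_of_card_eq (by simp)
  have hb0 : b 0 = u := hb 0 rfl
  have hbb : ∀ i j, b i 0 * b j 0 + b i 1 * b j 1 + b i 2 * b j 2 = if i = j then 1 else 0 := by
    intro i j
    rw [← hin, b.inner_eq_ite]
  have hbu : ∀ j, j ≠ 0 → c 1 * b j 0 + c 2 * b j 1 + c 3 * b j 2 = 0 := by
    intro j hj
    have h := hbb 0 j
    rw [hb0, if_neg hj.symm] at h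
    simp only [hu] at h
    simp at h
    field_simp at h
    linarith
  refine ⟨∑ i, (![1, 0, 0, 0] : Fin 4 → ℝ) i • e i, ∑ i, ![0, b 1 0, b 1 1, b 1 2] i • e i,
    ∑ i, ![0, b 2 0, b 2 1, b 2 2] i • e i, ?_⟩
  simp only [hG]
  have h1 := hbu 1 (by decide)
  have h2 := hbu 2 (by decide)
  have h3 := hbb 1 1
  have h4 := hbb 2 2
  have h5 := hbb 1 2
  simp only [if_true] at h3 h4
  rw [if_neg (by decide)] at h5
  simp
  refine ⟨hc0, ?_, ?_, ?_, ?_, ?_⟩ <;> linarith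

/-- The null frame determined by real fields `l, n, a, b`, where `m = a + i b`. -/
def NullFrame.ofReal (l n a b : VField M) (sl : SmoothFieldOn l U) (sn : SmoothFieldOn n U)
    (sa : SmoothFieldOn a U) (sb : SmoothFieldOn b U) (hll : ∀ q ∈ U, g.pair l l q = 0)
    (hnn : ∀ q ∈ U, g.pair n n q = 0) (hln : ∀ q ∈ U, g.pair l n q = 1)
    (hla : ∀ q ∈ U, g.pair l a q = 0) (hlb : ∀ q ∈ U, g.pair l b q = 0)
    (hna : ∀ q ∈ U, g.pair n a q = 0) (hnb : ∀ q ∈ U, g.pair n b q = 0)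
    (haa : ∀ q ∈ U, g.pair a a q = -1 / 2) (hbb : ∀ q ∈ U, g.pair b b q = -1 / 2)
    (hab : ∀ q ∈ U, g.pair a b q = 0) : NullFrame g U where
  l := l
  n := n
  m := ⟨a, b⟩
  smooth_l := sl
  smooth_n := sn
  smooth_re := sa
  smooth_im := sb
  l_l := hll
  n_n := hnn
  l_n := hln
  l_m q hq := by
    have h1 := hla q hq
    have h2 := hlb q hq
    rw [pair_apply] at h1 h2
    apply Complex.ext <;> simp [LorentzMetric.cpair, CField.ofReal, pair_apply, h1, h2]
  n_m q hq := by
    have h1 := hna q hq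
    have h2 := hnb q hq
    rw [pair_apply] at h1 h2
    apply Complex.ext <;> simp [LorentzMetric.cpair, CField.ofReal, pair_apply, h1, h2]
  m_m q hq := by
    apply Complex.ext <;>
      simp [LorentzMetric.cpair, haa q hq, hbb q hq, hab q hq, pair_comm b a]
  m_conj q hq := by
    have h1 := haa q hq
    have h2 := hbb q hq
    have h3 := hab q hq
    rw [pair_apply] at h1 h2 h3
    have h4 := (g.symm q _ _).trans h3
    apply Complex.ext <;>
      simp [LorentzMetric.cpair, CField.conj, pair_apply, h1, h2, h3, h4]

/-- The scaling aims at square `-1 / 2`, the value for the real and imaginary parts of `m`;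
negativity keeps the root away from its singularity. -/
theorem SmoothFieldAt.normalize {X : VField M} (hX : SmoothFieldAt X q) (h : g.pair X X q < 0) :
    SmoothFieldAt ((fun x ↦ (√(-2 * g.pair X X x))⁻¹) • X) q := by
  have h0 : -2 * g.pair X X q ≠ 0 := by linarith
  have h1 : ContDiffAt ℝ ∞ (fun t : ℝ ↦ (√(-2 * t))⁻¹) (g.pair X X q) :=
    ((Real.contDiffAt_sqrt h0).comp (g.pair X X q)
      (contDiffAt_const.mul contDiffAt_id)).inv (Real.sqrt_ne_zero'.2 (by linarith))
  exact SmoothFieldAt.smul (h1.comp_contMDiffAt (hX.pair hX)) hX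

theorem pair_normalize {X : VField M} (h : g.pair X X q < 0) :
    g.pair ((fun x ↦ (√(-2 * g.pair X X x))⁻¹) • X) ((fun x ↦ (√(-2 * g.pair X X x))⁻¹) • X) q
      = -1 / 2 := by
  have h0 : 0 < -2 * g.pair X X q := by linarith
  have h1 := Real.mul_self_sqrt h0.le
  have h2 : √(-2 * g.pair X X q) ≠ 0 := (Real.sqrt_pos.2 h0).ne'
  simp only [pair_smul_left, pair_smul_right, Pi.mul_apply]
  set s := √(-2 * g.pair X X q)
  have h3 : g.pair X X q = -1 / 2 * (s * s) := by linarith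
  rw [h3]
  field_simp

theorem SmoothFieldAt.eventually_pair_neg {X : VField M} (hX : SmoothFieldAt X p)
    (h : g.pair X X p < 0) : ∀ᶠ q in 𝓝 p, g.pair X X q < 0 :=
  (hX.pair hX).continuousAt.eventually (gt_mem_nhds h)

/-- A null field is locally the first leg of a null frame. -/
theorem exists_nullFrame_of_isNullFieldOn {L : VField M} (hU : IsOpen U) (hp : p ∈ U)
    (hL : IsNullFieldOn g U L) :
    ∃ V : Set M, IsOpen V ∧ p ∈ V ∧ V ⊆ U ∧ ∃ e : NullFrame g V, e.l = L := by
  obtain ⟨k, x, y, hlk, hlx, hly, hkx, hky, hxx, hyy, hxy⟩ :=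
    exists_null_basis (hL.2 p hp).1 (hL.2 p hp).2
  obtain ⟨K, hK, sK⟩ := exists_smoothFieldAt_extension k
  obtain ⟨X, hX, sX⟩ := exists_smoothFieldAt_extension x
  obtain ⟨Y, hY, sY⟩ := exists_smoothFieldAt_extension y
  have sL : ∀ᶠ q in 𝓝 p, SmoothFieldAt L q := by
    filter_upwards [hU.mem_nhds hp] with q hq using hL.1.at hU hq
  have hLL : ∀ᶠ q in 𝓝 p, g.pair L L q = 0 := by
    filter_upwards [hU.mem_nhds hp] with q hq using (hL.2 q hq).2
  have hLK : ∀ᶠ q in 𝓝 p, g.pair L K q ≠ 0 :=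
    (sL.self_of_nhds.pair sK.self_of_nhds).continuousAt.eventually_ne (by rwa [pair_apply, hK])
  -- The first term has product `1` with `L`; the multiple of `L` does not alter this and is chosen
  -- to cancel the square of the first term.
  set N : VField M := (g.pair L K)⁻¹ • K
    + (fun q ↦ -(g.pair K K q * ((g.pair L K q)⁻¹ * (g.pair L K q)⁻¹) / 2)) • L with hN
  have sN : ∀ᶠ q in 𝓝 p, SmoothFieldAt N q := by
    filter_upwards [sL, sK, hLK] with q sL sK hLK
    have h1 : ContMDiffAt (𝓡 4) 𝓘(ℝ, ℝ) ∞ (g.pair L K)⁻¹ q :=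
      (contDiffAt_inv ℝ hLK).comp_contMDiffAt (sL.pair sK)
    exact (SmoothFieldAt.smul h1 sK).add
      (SmoothFieldAt.smul (((sK.pair sK).mul (h1.mul h1)).div_const 2).neg sL)
  have hLN : ∀ᶠ q in 𝓝 p, g.pair L N q = 1 := by
    filter_upwards [hLL, hLK] with q hLL hLK
    simp only [hN, pair_add_right, pair_smul_right, Pi.add_apply, Pi.mul_apply, Pi.inv_apply, hLL]
    field_simp
    simp
  have hNN : ∀ᶠ q in 𝓝 p, g.pair N N q = 0 := by
    filter_upwards [hLL, hLK] with q hLL hLK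
    simp only [hN, pair_add_right, pair_smul_right, pair_add_left, pair_smul_left, Pi.add_apply,
      Pi.mul_apply, Pi.inv_apply, hLL, pair_comm K L]
    field_simp
    ring
  have hproj : ∀ Z : VField M, ∀ᶠ q in 𝓝 p,
      g.pair L (Z + (-g.pair N Z) • L + (-g.pair L Z) • N) q = 0 ∧
      g.pair N (Z + (-g.pair N Z) • L + (-g.pair L Z) • N) q = 0 := by
    intro Z
    filter_upwards [hLL, hNN, hLN] with q hLL hNN hLN
    simp only [pair_add_right, pair_smul_right, pair_comm N L, Pi.add_apply, Pi.mul_apply,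
      Pi.neg_apply, hLL, hNN, hLN]
    constructor <;> ring
  have sproj : ∀ Z : VField M, (∀ᶠ q in 𝓝 p, SmoothFieldAt Z q) → ∀ᶠ q in 𝓝 p,
      SmoothFieldAt (Z + (-g.pair N Z) • L + (-g.pair L Z) • N) q := by
    intro Z sZ
    filter_upwards [sZ, sL, sN] with q sZ sL sN
    exact (sZ.add (SmoothFieldAt.smul (sN.pair sZ).neg sL)).add
      (SmoothFieldAt.smul (sL.pair sZ).neg sN)
  -- The projection changes nothing at `p`, where `z` is already orthogonal to `L` and `k`; so the
  -- signs of squares at `p` are kept.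
  have hZ : ∀ (Z : VField M) (z), Z p = z → (∀ᶠ q in 𝓝 p, SmoothFieldAt Z q) →
      g.inner p (L p) z = 0 → g.inner p k z = 0 → ∃ Z' : VField M, Z' p = z ∧
      (∀ᶠ q in 𝓝 p, SmoothFieldAt Z' q) ∧ ∀ᶠ q in 𝓝 p, g.pair L Z' q = 0 ∧ g.pair N Z' q = 0 := by
    rintro Z z rfl sZ h1 h2
    refine ⟨_, ?_, sproj Z sZ, hproj Z⟩
    have h3 : g.inner p (N p) (Z p) = 0 := by simp [hN, hK, h1, h2]
    simp [pair_apply, h3, h1]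
  obtain ⟨X₁, hX₁, sX₁, oX₁⟩ := hZ X x hX sX hlx hkx
  obtain ⟨Y₀, hY₀, sY₀, oY₀⟩ := hZ Y y hY sY hly hky
  have nX₁ := sX₁.self_of_nhds.eventually_pair_neg (g := g) (by rw [pair_apply, hX₁, hxx]; norm_num)
  obtain ⟨X₂, a, hX₂, sX₂, hXX⟩ : ∃ (X₂ : VField M) (a : M → ℝ), X₂ = a • X₁ ∧
      (∀ᶠ q in 𝓝 p, SmoothFieldAt X₂ q) ∧ ∀ᶠ q in 𝓝 p, g.pair X₂ X₂ q = -1 / 2 := by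
    refine ⟨_, fun x ↦ (√(-2 * g.pair X₁ X₁ x))⁻¹, rfl, ?_, ?_⟩
    · filter_upwards [sX₁, nX₁] with q h1 h2 using h1.normalize h2
    · filter_upwards [nX₁] with q h2 using pair_normalize h2
  have hLX : ∀ᶠ q in 𝓝 p, g.pair L X₂ q = 0 ∧ g.pair N X₂ q = 0 := by
    filter_upwards [oX₁] with q h
    simp [hX₂, pair_smul_right, h.1, h.2]
  obtain ⟨Y₁, hY₁, sY₁, oY₁⟩ : ∃ Y₁ : VField M, Y₁ p = y ∧ (∀ᶠ q in 𝓝 p, SmoothFieldAt Y₁ q) ∧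
      ∀ᶠ q in 𝓝 p, g.pair L Y₁ q = 0 ∧ g.pair N Y₁ q = 0 ∧ g.pair X₂ Y₁ q = 0 := by
    -- Gram–Schmidt; the coefficient is `2` because `X₂` has square `-1 / 2`.
    refine ⟨Y₀ + (fun q ↦ 2 * g.pair X₂ Y₀ q) • X₂, ?_, ?_, ?_⟩
    · simp [hY₀, pair_apply, hX₂, hX₁, hxy]
    · filter_upwards [sY₀, sX₂] with q h1 h2
      exact h1.add (SmoothFieldAt.smul (contMDiffAt_const.mul (h2.pair h1)) h2)
    · filter_upwards [oY₀, hLX, hXX] with q h h' h''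
      simp only [pair_smul_right, pair_add_right, Pi.add_apply, Pi.mul_apply, h'.1, h'.2, h'',
        h.1, h.2]
      refine ⟨by simp, by simp, by ring⟩
  have nY₁ := sY₁.self_of_nhds.eventually_pair_neg (g := g) (by rw [pair_apply, hY₁, hyy]; norm_num)
  obtain ⟨Y₂, b, hY₂, sY₂, hYY⟩ : ∃ (Y₂ : VField M) (b : M → ℝ), Y₂ = b • Y₁ ∧
      (∀ᶠ q in 𝓝 p, SmoothFieldAt Y₂ q) ∧ ∀ᶠ q in 𝓝 p, g.pair Y₂ Y₂ q = -1 / 2 := by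
    refine ⟨_, fun x ↦ (√(-2 * g.pair Y₁ Y₁ x))⁻¹, rfl, ?_, ?_⟩
    · filter_upwards [sY₁, nY₁] with q h1 h2 using h1.normalize h2
    · filter_upwards [nY₁] with q h2 using pair_normalize h2
  have hLY : ∀ᶠ q in 𝓝 p, g.pair L Y₂ q = 0 ∧ g.pair N Y₂ q = 0 ∧ g.pair X₂ Y₂ q = 0 := by
    filter_upwards [oY₁] with q h
    simp [hY₂, pair_smul_right, h.1, h.2.1, h.2.2]
  have hUp : ∀ᶠ q in 𝓝 p, q ∈ U := hU.mem_nhds hp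
  obtain ⟨W, hW, hWo, hpW⟩ := eventually_nhds_iff.1 (hUp.and
    (sL.and (sN.and (sX₂.and (sY₂.and (hLL.and (hNN.and (hLN.and (hLX.and (hLY.and
      (hXX.and hYY)))))))))))
  refine ⟨W, hWo, hpW, fun q hq ↦ (hW q hq).1, NullFrame.ofReal L N X₂ Y₂
    (smoothFieldOn_of_at fun q hq ↦ ?_) (smoothFieldOn_of_at fun q hq ↦ ?_)
    (smoothFieldOn_of_at fun q hq ↦ ?_) (smoothFieldOn_of_at fun q hq ↦ ?_)
    (fun q hq ↦ ?_) (fun q hq ↦ ?_) (fun q hq ↦ ?_) (fun q hq ↦ ?_) (fun q hq ↦ ?_)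
    (fun q hq ↦ ?_) (fun q hq ↦ ?_) (fun q hq ↦ ?_) (fun q hq ↦ ?_) (fun q hq ↦ ?_), rfl⟩ <;>
  obtain ⟨-, h1, h2, h3, h4, h5, h6, h7, h8, h9, h10, h11⟩ := hW q hq
  exacts [h1, h2, h3, h4, h5, h6, h7, h8.1, h9.1, h8.2, h9.2.1, h10, h11, h9.2.2]

theorem hasKundtFramesNear_of_isKundtNear (h : IsKundtNear g p) : HasKundtFramesNear g p := by
  obtain ⟨U, hU, hp, L, hL, h1, h2, h3⟩ := h
  obtain ⟨V, hV, hpV, hVU, e, rfl⟩ := exists_nullFrame_of_isNullFieldOn hU hp hL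
  have he : KundtConditionsOn g V e.toTetrad :=
    kundtConditionsOn_of_isHypersurfaceOrthogonalOn hV e (fun q hq ↦ h1 q (hVU hq))
      (fun q hq ↦ h2 q (hVU hq)) (fun q hq ↦ h3 q (hVU hq))
  refine ⟨V, hV, hpV, {e' | SameFamily e e'}, ⟨e, Relation.EqvGen.refl e⟩, fun a ha b ↦ ?_,
    fun a ha ↦ (SameFamily.kundtConditionsOn_iff hV ha).2 he⟩
  exact ⟨fun hb ↦ (Relation.EqvGen.symm _ _ ha).trans _ _ _ hb, fun hb ↦ ha.trans _ _ _ hb⟩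

end LocalFrames

/-! ### Spin-boosts and the transport equations for `ε` -/

section Boosts

variable {M : Type*} [TopologicalSpace M] [ChartedSpace (EuclideanSpace ℝ (Fin 4)) M]
  [IsManifold (𝓡 4) ∞ M] {g : LorentzMetric M} {U : Set M} {p q : M}

/-- The equation `X(u) = f` for smooth `X, f` is locally solvable where `X` does not vanish. -/
theorem exists_smooth_solution_dir {X : VField M} {f : M → ℝ}
    (hX : ∀ᶠ q in 𝓝 p, SmoothFieldAt X q)
    (hf : ∀ᶠ q in 𝓝 p, ContMDiffAt (𝓡 4) 𝓘(ℝ, ℝ) ∞ f q) (h0 : X p ≠ 0) :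
    ∃ u : M → ℝ, ∀ᶠ q in 𝓝 p, ContMDiffAt (𝓡 4) 𝓘(ℝ, ℝ) ∞ u q ∧ dir X u q = f q := by
  set φ := extChartAt (𝓡 4) p with hφ
  set t := trivializationAt (EuclideanSpace ℝ (Fin 4)) (TangentSpace (𝓡 4) : M → Type _) p with ht
  have hpt : p ∈ t.baseSet := FiberBundle.mem_baseSet_trivializationAt' p
  set F : M → EuclideanSpace ℝ (Fin 4) := fun q ↦ (t ⟨q, X q⟩).2 with hF
  -- The fibre coordinate of `X` is its image under the differential of the chart, so the chain rule
  -- turns a solution in coordinates into one on `M`.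
  have hFm : ∀ q ∈ t.baseSet, F q = mfderiv (𝓡 4) 𝓘(ℝ, EuclideanSpace ℝ (Fin 4)) φ q (X q) := by
    intro q hq
    have hq' : q ∈ (chartAt (EuclideanSpace ℝ (Fin 4)) p).source := hq
    have h : t.continuousLinearMapAt ℝ q (X q) = F q := by
      rw [t.continuousLinearMapAt_apply (R := ℝ), t.linearMapAt_apply (R := ℝ), if_pos hq]
    exact h.symm.trans
      (DFunLike.congr_fun (TangentBundle.continuousLinearMapAt_trivializationAt hq') (X q))
  have hFs : ∀ᶠ q in 𝓝 p, ContMDiffAt (𝓡 4) 𝓘(ℝ, EuclideanSpace ℝ (Fin 4)) ∞ F q := by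
    filter_upwards [hX, t.open_baseSet.mem_nhds hpt] with q hq hqt
    exact (t.contMDiffAt_section_iff hqt).1 hq
  have hsymm : ∀ᶠ y in 𝓝 (φ p), ContMDiffAt 𝓘(ℝ, EuclideanSpace ℝ (Fin 4)) (𝓡 4) ∞ φ.symm y := by
    filter_upwards [extChartAt_target_mem_nhds (I := 𝓡 4) p] with y hy
    exact (contMDiffOn_extChartAt_symm p).contMDiffAt
      ((isOpen_extChartAt_target p).mem_nhds hy)
  have hsp : φ.symm (φ p) = p := extChartAt_to_inv p
  have htend : Filter.Tendsto φ.symm (𝓝 (φ p)) (𝓝 p) := by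
    have h := hsymm.self_of_nhds.continuousAt
    rwa [ContinuousAt, hsp] at h
  have hφt : Filter.Tendsto φ (𝓝 p) (𝓝 (φ p)) := continuousAt_extChartAt p
  have h1 : ∀ᶠ y in 𝓝 (φ p), ContDiffAt ℝ ∞ (F ∘ φ.symm) y := by
    filter_upwards [hsymm, htend.eventually hFs] with y hy hFy
    exact (hFy.comp y hy).contDiffAt
  have h2 : ∀ᶠ y in 𝓝 (φ p), ContDiffAt ℝ ∞ (f ∘ φ.symm) y := by
    filter_upwards [hsymm, htend.eventually hf] with y hy hfy
    exact (hfy.comp y hy).contDiffAt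
  have h3 : (F ∘ φ.symm) (φ p) ≠ 0 := by
    rw [Function.comp_apply, hsp]
    intro h
    apply h0
    have h4 := t.mk_symm hpt (0 : EuclideanSpace ℝ (Fin 4))
    have h5 : t.continuousLinearEquivAt ℝ p hpt (X p) = 0 := h
    exact (t.continuousLinearEquivAt ℝ p hpt).map_eq_zero_iff.1 h5
  obtain ⟨u, hu⟩ := exists_smooth_solution_fderiv h1 h2 h3
  refine ⟨u ∘ φ, ?_⟩
  filter_upwards [hφt.eventually hu, extChartAt_source_mem_nhds (I := 𝓡 4) p,
    t.open_baseSet.mem_nhds hpt] with q ⟨hu1, hu2⟩ hq hqt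
  have hφq : ContMDiffAt (𝓡 4) 𝓘(ℝ, EuclideanSpace ℝ (Fin 4)) ∞ φ q :=
    contMDiffAt_extChartAt' (by rwa [extChartAt_source] at hq)
  refine ⟨hu1.comp_contMDiffAt hφq, ?_⟩
  have hleft : φ.symm (φ q) = q := φ.left_inv hq
  simp only [Function.comp_apply, hleft] at hu2
  rw [← hu2, hFm q hqt]
  change (mfderiv (𝓡 4) 𝓘(ℝ, ℝ) (u ∘ φ) q (X q) : ℝ) = _
  rw [mfderiv_comp (I' := 𝓘(ℝ, EuclideanSpace ℝ (Fin 4))) q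
    (hu1.contMDiffAt.mdifferentiableAt (by simp)) (hφq.mdifferentiableAt (by simp)),
    mfderiv_eq_fderiv]
  rfl

/-- The spin-boost of a null frame with `A = exp u` and `w = exp (i θ)`. -/
noncomputable def boostFrame (e : NullFrame g U) (u θ : M → ℝ) (hU : IsOpen U)
    (hu : ∀ q ∈ U, ContMDiffAt (𝓡 4) 𝓘(ℝ, ℝ) ∞ u q)
    (hθ : ∀ q ∈ U, ContMDiffAt (𝓡 4) 𝓘(ℝ, ℝ) ∞ θ q) : NullFrame g U :=
  have hc : ∀ q ∈ U, ContMDiffAt (𝓡 4) 𝓘(ℝ, ℝ) ∞ (Real.cos ∘ θ) q := fun q hq ↦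
    Real.contDiff_cos.comp_contMDiffAt (hθ q hq)
  have hs : ∀ q ∈ U, ContMDiffAt (𝓡 4) 𝓘(ℝ, ℝ) ∞ (Real.sin ∘ θ) q := fun q hq ↦
    Real.contDiff_sin.comp_contMDiffAt (hθ q hq)
  NullFrame.ofReal (U := U) (Real.exp ∘ u • e.l) (Real.exp ∘ (-u) • e.n)
    (Real.cos ∘ θ • e.m.re + (-(Real.sin ∘ θ)) • e.m.im)
    (Real.cos ∘ θ • e.m.im + (Real.sin ∘ θ) • e.m.re)
    (smoothFieldOn_of_at fun q hq ↦
      SmoothFieldAt.smul (Real.contDiff_exp.comp_contMDiffAt (hu q hq)) (e.smooth_l_at hU hq))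
    (smoothFieldOn_of_at fun q hq ↦
      SmoothFieldAt.smul (Real.contDiff_exp.comp_contMDiffAt (hu q hq).neg) (e.smooth_n_at hU hq))
    (smoothFieldOn_of_at fun q hq ↦ (SmoothFieldAt.smul (hc q hq) (e.smooth_re_at hU hq)).add
      (SmoothFieldAt.smul (hs q hq).neg (e.smooth_im_at hU hq)))
    (smoothFieldOn_of_at fun q hq ↦ (SmoothFieldAt.smul (hc q hq) (e.smooth_im_at hU hq)).add
      (SmoothFieldAt.smul (hs q hq) (e.smooth_re_at hU hq)))
    (fun q hq ↦ by simp [pair_smul_left, pair_smul_right, e.l_l q hq])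
    (fun q hq ↦ by simp [pair_smul_left, pair_smul_right, e.n_n q hq])
    (fun q hq ↦ by
      simp [pair_smul_left, pair_smul_right, e.l_n q hq, ← Real.exp_add])
    (fun q hq ↦ by
      simp only [pair_smul_left, pair_add_right, pair_smul_right, Pi.add_apply, Pi.mul_apply,
        e.l_re hq, e.l_im hq, mul_zero, add_zero])
    (fun q hq ↦ by
      simp only [pair_smul_left, pair_add_right, pair_smul_right, Pi.add_apply, Pi.mul_apply,
        e.l_re hq, e.l_im hq, mul_zero, add_zero])
    (fun q hq ↦ by
      simp only [pair_smul_left, pair_add_right, pair_smul_right, Pi.add_apply, Pi.mul_apply,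
        e.n_re hq, e.n_im hq, mul_zero, add_zero])
    (fun q hq ↦ by
      simp only [pair_smul_left, pair_add_right, pair_smul_right, Pi.add_apply, Pi.mul_apply,
        e.n_re hq, e.n_im hq, mul_zero, add_zero])
    (fun q hq ↦ by
      simp only [pair_add_left, pair_smul_left, pair_add_right, pair_smul_right, Pi.add_apply,
        Pi.mul_apply, Pi.neg_apply, Function.comp_apply, pair_comm e.m.im e.m.re, e.re_re hq,
        e.im_im hq, e.re_im hq]
      linear_combination (-1 / 2) * Real.sin_sq_add_cos_sq (θ q))
    (fun q hq ↦ by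
      simp only [pair_add_left, pair_smul_left, pair_add_right, pair_smul_right, Pi.add_apply,
        Pi.mul_apply, Function.comp_apply, pair_comm e.m.im e.m.re, e.re_re hq,
        e.im_im hq, e.re_im hq]
      linear_combination (-1 / 2) * Real.sin_sq_add_cos_sq (θ q))
    (fun q hq ↦ by
      simp only [pair_add_left, pair_smul_left, pair_add_right, pair_smul_right, Pi.add_apply,
        Pi.mul_apply, Pi.neg_apply, Function.comp_apply, pair_comm e.m.im e.m.re, e.re_re hq,
        e.im_im hq, e.re_im hq]
      ring)

theorem isSpinBoostOn_boostFrame (e : NullFrame g U) (u θ : M → ℝ) (hU : IsOpen U)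
    (hu : ∀ q ∈ U, ContMDiffAt (𝓡 4) 𝓘(ℝ, ℝ) ∞ u q)
    (hθ : ∀ q ∈ U, ContMDiffAt (𝓡 4) 𝓘(ℝ, ℝ) ∞ θ q) :
    IsSpinBoostOn U e.toTetrad (boostFrame e u θ hU hu hθ).toTetrad := by
  have hw : ContDiff ℝ ∞ fun x : ℝ ↦ Complex.exp (x * Complex.I) :=
    (Complex.ofRealCLM.contDiff.mul contDiff_const).cexp
  refine ⟨Real.exp ∘ u, (fun x : ℝ ↦ Complex.exp (x * Complex.I)) ∘ θ,
    fun q hq ↦ (Real.contDiff_exp.comp_contMDiffAt (hu q hq)).contMDiffWithinAt,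
    fun q hq ↦ (hw.comp_contMDiffAt (hθ q hq)).contMDiffWithinAt,
    fun q _ ↦ ⟨Real.exp_pos _, Complex.norm_exp_ofReal_mul_I _, rfl, ?_, ?_, ?_⟩⟩
  · simp [boostFrame, NullFrame.ofReal, Real.exp_neg]
  · simp [boostFrame, NullFrame.ofReal, Complex.exp_ofReal_mul_I_re, Complex.exp_ofReal_mul_I_im,
      sub_eq_add_neg]
  · simp [boostFrame, NullFrame.ofReal, Complex.exp_ofReal_mul_I_re, Complex.exp_ofReal_mul_I_im]

/-- The chain rule for directional derivatives. -/
theorem dir_comp {X : VField M} {h : ℝ → ℝ} {h' : ℝ} {u : M → ℝ} (hu : DiffAt u q)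
    (hh : HasDerivAt h h' (u q)) : dir X (h ∘ u) q = h' * dir X u q := by
  change (mfderiv (𝓡 4) 𝓘(ℝ, ℝ) (h ∘ u) q (X q) : ℝ) =
    h' * (show ℝ from mfderiv (𝓡 4) 𝓘(ℝ, ℝ) u q (X q))
  rw [mfderiv_comp (I' := 𝓘(ℝ, ℝ)) q hh.differentiableAt.mdifferentiableAt hu,
    mfderiv_eq_fderiv]
  change fderiv ℝ h (u q) (mfderiv (𝓡 4) 𝓘(ℝ, ℝ) u q (X q)) = _
  rw [hh.hasFDerivAt.fderiv]
  exact mul_comm _ h'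

theorem nabla_add_nabla_swap_of_eventually_const {c : ℝ} (X Y Z : VField M)
    (h : ∀ᶠ x in 𝓝 q, g.pair Y Z x = c) : g.nabla X Y Z q + g.nabla X Z Y q = 0 := by
  rw [nabla_add_nabla_swap, dir_congr (f' := fun _ ↦ c) rfl h]
  simp [dir, mvfderiv_const]

theorem NullFrame.nabla_re_re (e : NullFrame g U) (hU : IsOpen U) (hq : q ∈ U) (X : VField M) :
    g.nabla X e.m.re e.m.re q = 0 := by
  have h := nabla_add_nabla_swap_of_eventually_const X e.m.re e.m.re
    (Filter.eventually_of_mem (hU.mem_nhds hq) fun x hx ↦ e.re_re hx)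
  linarith

theorem NullFrame.nabla_im_im (e : NullFrame g U) (hU : IsOpen U) (hq : q ∈ U) (X : VField M) :
    g.nabla X e.m.im e.m.im q = 0 := by
  have h := nabla_add_nabla_swap_of_eventually_const X e.m.im e.m.im
    (Filter.eventually_of_mem (hU.mem_nhds hq) fun x hx ↦ e.im_im hx)
  linarith

theorem NullFrame.nabla_im_re (e : NullFrame g U) (hU : IsOpen U) (hq : q ∈ U) (X : VField M) :
    g.nabla X e.m.im e.m.re q = - g.nabla X e.m.re e.m.im q := by
  have h := nabla_add_nabla_swap_of_eventually_const X e.m.re e.m.im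
    (Filter.eventually_of_mem (hU.mem_nhds hq) fun x hx ↦ e.re_im hx)
  linarith

/-- The products of `m.re, m.im` are constant, so `∇_ℓ` acts on them by an antisymmetric matrix:
diagonal terms drop out and the off-diagonal ones combine. -/
theorem NullFrame.epsilon_eq (e : NullFrame g U) (hU : IsOpen U) (hq : q ∈ U) :
    epsilon g e.toTetrad q =
      (⟨g.nabla e.l e.l e.n q, 2 * g.nabla e.l e.m.re e.m.im q⟩ : ℂ) / 2 := by
  rw [Kundt.epsilon_eq (e.smooth_l_at hU hq) (e.smooth_n_at hU hq) (e.smooth_re_at hU hq)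
    (e.smooth_im_at hU hq), e.nabla_re_re hU hq, e.nabla_im_im hU hq, e.nabla_im_re hU hq]
  congr 2 <;> ring

/-- The transformation of `ε` under a spin-boost. -/
theorem epsilon_boostFrame (e : NullFrame g U) (u θ : M → ℝ) (hU : IsOpen U)
    (hu : ∀ q ∈ U, ContMDiffAt (𝓡 4) 𝓘(ℝ, ℝ) ∞ u q)
    (hθ : ∀ q ∈ U, ContMDiffAt (𝓡 4) 𝓘(ℝ, ℝ) ∞ θ q) (hq : q ∈ U) :
    epsilon g (boostFrame e u θ hU hu hθ).toTetrad q =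
      (⟨Real.exp (u q) * (g.nabla e.l e.l e.n q + dir e.l u q),
        Real.exp (u q) * (2 * g.nabla e.l e.m.re e.m.im q + dir e.l θ q)⟩ : ℂ) / 2 := by
  have hl := (e.smooth_l_at hU hq).diff
  have hn := (e.smooth_n_at hU hq).diff
  have hre := (e.smooth_re_at hU hq).diff
  have him := (e.smooth_im_at hU hq).diff
  have hu' : DiffAt u q := (hu q hq).mdifferentiableAt (by simp)
  have hθ' : DiffAt θ q := (hθ q hq).mdifferentiableAt (by simp)
  have hA : DiffAt (Real.exp ∘ u) q :=
    (Real.contDiff_exp.comp_contMDiffAt (hu q hq)).mdifferentiableAt (by simp)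
  have hB : DiffAt (Real.exp ∘ (-u)) q :=
    (Real.contDiff_exp.comp_contMDiffAt (hu q hq).neg).mdifferentiableAt (by simp)
  have hC : DiffAt (Real.cos ∘ θ) q :=
    (Real.contDiff_cos.comp_contMDiffAt (hθ q hq)).mdifferentiableAt (by simp)
  have hS : DiffAt (Real.sin ∘ θ) q :=
    (Real.contDiff_sin.comp_contMDiffAt (hθ q hq)).mdifferentiableAt (by simp)
  have hS' : DiffAt (-(Real.sin ∘ θ)) q :=
    ((Real.contDiff_sin.comp_contMDiffAt (hθ q hq)).neg).mdifferentiableAt (by simp)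
  have hAl : DiffFieldAt (Real.exp ∘ u • e.l) q :=
    (SmoothFieldAt.smul (Real.contDiff_exp.comp_contMDiffAt (hu q hq)) (e.smooth_l_at hU hq)).diff
  have hBn : DiffFieldAt (Real.exp ∘ (-u) • e.n) q := hB.smul_section hn
  have hCre : DiffFieldAt (Real.cos ∘ θ • e.m.re) q := hC.smul_section hre
  have hSim : DiffFieldAt ((-(Real.sin ∘ θ)) • e.m.im) q := hS'.smul_section him
  have hCim : DiffFieldAt (Real.cos ∘ θ • e.m.im) q := hC.smul_section him
  have hSre : DiffFieldAt (Real.sin ∘ θ • e.m.re) q := hS.smul_section hre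
  have hsum : DiffFieldAt (Real.cos ∘ θ • e.m.im + Real.sin ∘ θ • e.m.re) q :=
    mdifferentiableAt_add_section hCim hSre
  have hdS : dir e.l (-(Real.sin ∘ θ)) q = - Real.cos (θ q) * dir e.l θ q :=
    dir_comp (h := fun x ↦ - Real.sin x) hθ' (Real.hasDerivAt_sin _).neg
  rw [NullFrame.epsilon_eq _ hU hq]
  congr 1
  apply Complex.ext
  · change g.nabla (Real.exp ∘ u • e.l) (Real.exp ∘ u • e.l) (Real.exp ∘ (-u) • e.n) q = _
    rw [nabla_smul_left hA hl hAl hBn, nabla_smul_right hB hl hAl hn,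
      nabla_smul_middle hA hl hl hn, dir_comp hu' (Real.hasDerivAt_exp _), e.l_n q hq]
    simp only [Function.comp_apply, Pi.neg_apply, Real.exp_neg]
    field_simp
  · change 2 * g.nabla (Real.exp ∘ u • e.l) (Real.cos ∘ θ • e.m.re + (-(Real.sin ∘ θ)) • e.m.im)
      (Real.cos ∘ θ • e.m.im + Real.sin ∘ θ • e.m.re) q = _
    -- Differentiating the rotation of `m` gives `-ℓ(θ)` times the new imaginary part, of square `-1
    -- / 2`; the factor `2` in front turns this into `ℓ(θ)`.
    rw [nabla_smul_left hA hl (mdifferentiableAt_add_section hCre hSim) hsum,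
      nabla_add_middle hl hCre hSim hsum,
      nabla_smul_middle hC hl hre hsum, nabla_smul_middle hS' hl him hsum,
      nabla_add_right hl hre hCim hSre, nabla_add_right hl him hCim hSre,
      nabla_smul_right hC hl hre him, nabla_smul_right hS hl hre hre,
      nabla_smul_right hC hl him him, nabla_smul_right hS hl him hre, hdS,
      dir_comp hθ' (Real.hasDerivAt_cos _), e.nabla_re_re hU hq, e.nabla_im_im hU hq,
      e.nabla_im_re hU hq]
    simp only [pair_add_right, pair_smul_right, Pi.add_apply, Pi.mul_apply, Pi.neg_apply,
      Function.comp_apply, pair_comm e.m.im e.m.re, e.re_re hq, e.im_im hq, e.re_im hq]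
    linear_combination Real.exp (u q) * (2 * g.nabla e.l e.m.re e.m.im q + dir e.l θ q) *
      Real.sin_sq_add_cos_sq (θ q)

/-- The restriction of a null frame to a smaller set. -/
def NullFrame.restrict (e : NullFrame g U) {V : Set M} (h : V ⊆ U) : NullFrame g V where
  toTetrad := e.toTetrad
  smooth_l := e.smooth_l.mono h
  smooth_n := e.smooth_n.mono h
  smooth_re := e.smooth_re.mono h
  smooth_im := e.smooth_im.mono h
  l_l q hq := e.l_l q (h hq)
  n_n q hq := e.n_n q (h hq)
  l_n q hq := e.l_n q (h hq)
  l_m q hq := e.l_m q (h hq)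
  n_m q hq := e.n_m q (h hq)
  m_m q hq := e.m_m q (h hq)
  m_conj q hq := e.m_conj q (h hq)

/-- Near each point, a spin-boost of a null frame with `κ = ρ = σ = 0` makes `ε` equal to a
positive multiple of a prescribed real constant. -/
theorem exists_spinBoost_epsilon (hU : IsOpen U) (e : NullFrame g U)
    (he : KundtConditionsOn g U e.toTetrad) (hp : p ∈ U) (c : ℝ) :
    ∃ V : Set M, IsOpen V ∧ p ∈ V ∧ V ⊆ U ∧ ∃ e' : NullFrame g V,
      IsSpinBoostOn V e.toTetrad e'.toTetrad ∧ KundtConditionsOn g V e'.toTetrad ∧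
      ∀ q ∈ V, ∃ r : ℝ, 0 < r ∧ epsilon g e'.toTetrad q = (r * c : ℝ) := by
  have hUp : ∀ᶠ q in 𝓝 p, q ∈ U := hU.mem_nhds hp
  have hl : ∀ᶠ q in 𝓝 p, SmoothFieldAt e.l q := hUp.mono fun q hq ↦ e.smooth_l_at hU hq
  have hl0 : e.l p ≠ 0 := ((isNullFieldOn_of_nullFrame e).2 p hp).1
  -- `u` makes the real part of the boosted `ε` equal to `exp u * c / 2`; `θ` below cancels the
  -- imaginary part.
  obtain ⟨u, hu⟩ := exists_smooth_solution_dir (f := fun q ↦ c - g.nabla e.l e.l e.n q) hl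
    (hUp.mono fun q hq ↦ contMDiffAt_const.sub
      ((e.smooth_l_at hU hq).nabla (e.smooth_l_at hU hq) (e.smooth_n_at hU hq))) hl0
  obtain ⟨θ, hθ⟩ := exists_smooth_solution_dir
    (f := fun q ↦ -2 * g.nabla e.l e.m.re e.m.im q) hl
    (hUp.mono fun q hq ↦ contMDiffAt_const.mul
      ((e.smooth_l_at hU hq).nabla (e.smooth_re_at hU hq) (e.smooth_im_at hU hq))) hl0
  obtain ⟨V, hV, hVo, hpV⟩ := eventually_nhds_iff.1 (hUp.and (hu.and hθ))
  have hVU : V ⊆ U := fun q hq ↦ (hV q hq).1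
  have hb := isSpinBoostOn_boostFrame (e.restrict hVU) u θ hVo (fun q hq ↦ (hV q hq).2.1.1)
    fun q hq ↦ (hV q hq).2.2.1
  refine ⟨V, hVo, hpV, hVU, _, hb, (hb.kundtConditionsOn_iff hVo).2 fun q hq ↦ he q (hVU hq),
    fun q hq ↦ ⟨Real.exp (u q) / 2, by positivity, ?_⟩⟩
  have h1 : dir (e.restrict hVU).l u q = c - g.nabla e.l e.l e.n q := (hV q hq).2.1.2
  have h2 : dir (e.restrict hVU).l θ q = -2 * g.nabla e.l e.m.re e.m.im q := (hV q hq).2.2.2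
  rw [epsilon_boostFrame _ u θ hVo _ _ hq, h1, h2]
  apply Complex.ext
  · simp only [NullFrame.restrict, Complex.div_ofNat_re, Complex.ofReal_re]
    ring
  · simp only [NullFrame.restrict, Complex.div_ofNat_im, Complex.ofReal_im]
    ring

end Boosts

end Kundt

theorem lemma2p1 {M : Type*} [TopologicalSpace M]
    [ChartedSpace (EuclideanSpace ℝ (Fin 4)) M] [IsManifold (𝓡 4) ∞ M]
    (g : Kundt.LorentzMetric M) :
    (∀ p : M, Kundt.IsKundtNear g p ↔ Kundt.HasKundtFramesNear g p) ∧
    (∀ U : Set M, IsOpen U → ∀ e : Kundt.NullFrame g U,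
      Kundt.KundtConditionsOn g U e.toTetrad →
        (∀ e' : Kundt.NullFrame g U, Kundt.IsSpinBoostOn U e.toTetrad e'.toTetrad →
          Kundt.KundtConditionsOn g U e'.toTetrad) ∧
        ∀ p ∈ U,
          (∃ V : Set M, IsOpen V ∧ p ∈ V ∧ V ⊆ U ∧ ∃ e' : Kundt.NullFrame g V,
            Kundt.IsSpinBoostOn V e.toTetrad e'.toTetrad ∧
            Kundt.KundtConditionsOn g V e'.toTetrad ∧
            ∀ q ∈ V, Kundt.epsilon g e'.toTetrad q = 0) ∧
          (∃ V : Set M, IsOpen V ∧ p ∈ V ∧ V ⊆ U ∧ ∃ e' : Kundt.NullFrame g V,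
            Kundt.IsSpinBoostOn V e.toTetrad e'.toTetrad ∧
            Kundt.KundtConditionsOn g V e'.toTetrad ∧
            ∀ q ∈ V, Kundt.epsilon g e'.toTetrad q ≠ 0)) := by
  refine ⟨fun p ↦ ⟨Kundt.hasKundtFramesNear_of_isKundtNear,
    Kundt.isKundtNear_of_hasKundtFramesNear⟩, fun U hU e he ↦
    ⟨fun e' h ↦ (h.kundtConditionsOn_iff hU).2 he, fun p hp ↦ ⟨?_, ?_⟩⟩⟩
  · obtain ⟨V, hV, hpV, hVU, e', hb, hK, hε⟩ := Kundt.exists_spinBoost_epsilon hU e he hp 0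
    refine ⟨V, hV, hpV, hVU, e', hb, hK, fun q hq ↦ ?_⟩
    obtain ⟨r, -, h⟩ := hε q hq
    simp [h]
  -- With `c = 1`, `ε` is a positive real at every point; `c = 0` above made it vanish.
  · obtain ⟨V, hV, hpV, hVU, e', hb, hK, hε⟩ := Kundt.exists_spinBoost_epsilon hU e he hp 1
    refine ⟨V, hV, hpV, hVU, e', hb, hK, fun q hq ↦ ?_⟩
    obtain ⟨r, hr, h⟩ := hε q hq
    simp [h, hr.ne']
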